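/- Let $d\ge 1$ and $b, F:\mathbb{R}^d\to\mathbb{R}^d$, where $F$ is bounded and Lipschitz with constant $L_F$, and $b$ is Lipschitz with constant $L_b$ and contractive at infinity: there are $m>0$ and $M\ge 0$ such that $\langle x-y, b(x)-b(y)\rangle\le -m|x-y|^2$ whenever $|x-y|\ge M$. Let $\beta>0$ and $\eta_\star>0$, and put $$\Delta t^\star=\min\Big\{\frac1m,\ \frac{m}{2(L_b+\eta_\star L_F)^2}\Big\}.$$ For $\eta\in\mathbb{R}$ and $\Delta t>0$, the discrete sticky-coupled chain $(X_k,Y_k)_{k\ge 0}$ on $\mathbb{R}^d\times\mathbb{R}^d$ is defined as follows. Let $(G_k)_{k\ge1}$ be i.i.d. standard Gaussian vectors in $\mathbb{R}^d$ and let $(U_k)_{k\ge 1}$ be i.i.d. uniform on $[0,1]$, independent of $(G_k)_{k\ge1}$. Set $\mathbf{E}(x,y)=y-x+\Delta t\,[b(y)-b(x)-\eta F(x)]$, and let $\mathbf{e}(x,y)=\mathbf{E}(x,y)/|\mathbf{E}(x,y)|$ if $\mathbf{E}(x,y)\ne0$ and $\mathbf{e}(x,y)=0$ otherwise. With $\varphi_d$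 the standard Gaussian density on $\mathbb{R}^d$, let $$p(x,y,g)=\min\Big\{1,\ \frac{\varphi_d\big(g-\sqrt{\beta/(2\Delta t)}\,\mathbf{E}(x,y)\big)}{\varphi_d(g)}\Big\}.$$ Then $$X_{k+1}=X_k+\Delta t\,[b(X_k)+\eta F(X_k)]+\sqrt{2\Delta t/\beta}\;G_{k+1},$$ and, with $\mathbf{e}_k=\mathbf{e}(X_k,Y_k)$, $$Y_{k+1}=\begin{cases}X_{k+1} & \text{if } U_{k+1}\le p(X_k,Y_k,G_{k+1}),\\ Y_k+\Delta t\, b(Y_k)+\sqrt{2\Delta t/\beta}\,\big[\mathrm{Id}-2\mathbf{e}_k\mathbf{e}_k^{T}\big]G_{k+1} & \text{otherwise.}\end{cases}$$ Denote by $T^{\eta,\Delta t}$ its transition kernel. For $c>0$ let $V_c(x,y)=e^{c|x|^2}+e^{c|y|^2}$, and for $f:\mathbb{R}^d\times\mathbb{R}^d\to\mathbb{R}$ let $\|f\|_{V_c}=\sup_{(x,y)}|f(x,y)|/V_c(x,y)$. Then there exist constants $C,c>0$ and, for every $\Delta t\in(0,\Delta t^\star)$, a constant $\gamma_{\Delta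 t}\in(0,1)$, such that for every $\Delta t\in(0,\Delta t^\star)$ and every $\eta\in[-\eta_\star,\eta_\star]$ the following holds. The kernel $T^{\eta,\Delta t}$ has a unique invariant probability measure $\mu_{\eta,\Delta t}$. Moreover, every measurable $\phi:\mathbb{R}^d\times\mathbb{R}^d\to\mathbb{R}$ with $\|\phi\|_{V_c}<\infty$ is integrable with respect to $\mu_{\eta,\Delta t}$ and to all the measures $(T^{\eta,\Delta t})^n(z,\cdot)$, and $$\forall n\ge0,\qquad \big\|(T^{\eta,\Delta t})^n\phi-\mu_{\eta,\Delta t}(\phi)\big\|_{V_c}\le C\,\gamma_{\Delta t}^{\,n}\,\big\|\phi-\mu_{\eta,\Delta t}(\phi)\big\|_{V_c}.$$ -/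

import Mathlib

open MeasureTheory ProbabilityTheory
open scoped NNReal ENNReal

noncomputable section

namespace StickyCoupling

/-- The Euclidean space `ℝ^d`. -/
abbrev Rd (d : ℕ) : Type := EuclideanSpace ℝ (Fin d)

/-- The standing assumption on the drift `b` and the perturbation `F`: `F` is bounded and
`LF`-Lipschitz, `b` is `Lb`-Lipschitz and contractive at infinity with constants `m > 0`, `M ≥ 0`. -/
structure DriftAssumption {d : ℕ} (b F : Rd d → Rd d) (Lb LF : ℝ≥0) (m M : ℝ) : Prop where
  lipschitz_F : LipschitzWith LF F
  bounded_F : ∃ B : ℝ, ∀ x, ‖F x‖ ≤ B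
  lipschitz_b : LipschitzWith Lb b
  m_pos : 0 < m
  M_nonneg : 0 ≤ M
  contractive : ∀ x y : Rd d, M ≤ ‖x - y‖ → inner ℝ (x - y) (b x - b y) ≤ -m * ‖x - y‖ ^ 2

/-- The density of the standard Gaussian distribution on `ℝ^d`. -/
def gaussDensity {d : ℕ} (g : Rd d) : ℝ :=
  (2 * Real.pi) ^ (-(d : ℝ) / 2) * Real.exp (-‖g‖ ^ 2 / 2)

variable {d : ℕ} (b F : Rd d → Rd d) (η Δt β : ℝ)

/-- `𝐄(x, y) = y - x + Δt (b(y) - b(x) - η F(x))`: the difference of the conditional means of the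
next positions of the second and of the first component. -/
def diffVec (x y : Rd d) : Rd d :=
  y - x + Δt • (b y - b x - η • F x)

/-- The normalization `𝐞(x, y)` of `𝐄(x, y)`, equal to `0` where `𝐄(x, y) = 0`. -/
def unitVec (x y : Rd d) : Rd d :=
  open Classical in
  if diffVec b F η Δt x y = 0 then 0
  else ‖diffVec b F η Δt x y‖⁻¹ • diffVec b F η Δt x y

/-- The meeting probability. If the first component uses the Gaussian increment `g`, the second one
reaches the same point with the increment `g - √(β / (2 Δt)) 𝐄(x, y)`; the probability is the
minimum of `1` and of the ratio of the densities of these two increments. -/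
def meetProb (x y g : Rd d) : ℝ :=
  min 1 (gaussDensity (g - √(β / (2 * Δt)) • diffVec b F η Δt x y) / gaussDensity g)

/-- One Euler-Maruyama step of the first component, with Gaussian increment `g`. -/
def stepX (x g : Rd d) : Rd d :=
  x + Δt • (b x + η • F x) + √(2 * Δt / β) • g

/-- One step of the second component when the two components are not forced together: the increment
is `(Id - 2 𝐞 𝐞ᵀ) g`. -/
def stepReflected (x y g : Rd d) : Rd d :=
  y + Δt • b y + √(2 * Δt / β) •
    (g - (2 * inner ℝ (unitVec b F η Δt x y) g) • unitVec b F η Δt x y)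

/-- The update rule of the discrete-time sticky-coupled chain: current state `w.1 = (x, y)`,
noise `w.2 = (g, u)`. -/
def step (w : (Rd d × Rd d) × (Rd d × ℝ)) : Rd d × Rd d :=
  open Classical in
  (stepX b F η Δt β w.1.1 w.2.1,
    if w.2.2 ≤ meetProb b F η Δt β w.1.1 w.1.2 w.2.1 then stepX b F η Δt β w.1.1 w.2.1
    else stepReflected b F η Δt β w.1.1 w.1.2 w.2.1)

/-- The law of the noise `(G, U)`: `G` standard Gaussian in `ℝ^d` and `U` uniform on `[0, 1]`,
independent of each other. -/
def noiseLaw (d : ℕ) : Measure (Rd d × ℝ) :=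
  (stdGaussian (Rd d)).prod (volume.restrict (Set.Icc (0 : ℝ) 1))

instance isProbabilityMeasure_noiseLaw (d : ℕ) : IsProbabilityMeasure (noiseLaw d) := by
  have : IsProbabilityMeasure (volume.restrict (Set.Icc (0 : ℝ) 1)) := ⟨by simp⟩
  unfold noiseLaw
  infer_instance

/-- The transition kernel `T^{η, Δt}` of the sticky-coupled chain: the law of
`step ((x, y), (G, U))`, see `stickyKernel_apply`. -/
def stickyKernel : Kernel (Rd d × Rd d) (Rd d × Rd d) :=
  (Kernel.id ×ₖ Kernel.const (Rd d × Rd d) (noiseLaw d)).map (step b F η Δt β)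

variable {b F}

theorem measurable_step (hb : Continuous b) (hF : Continuous F) :
    Measurable (step b F η Δt β) := by
  have hE : Measurable fun w : (Rd d × Rd d) × (Rd d × ℝ) => diffVec b F η Δt w.1.1 w.1.2 := by
    unfold diffVec
    exact Continuous.measurable (by fun_prop)
  have he : Measurable fun w : (Rd d × Rd d) × (Rd d × ℝ) => unitVec b F η Δt w.1.1 w.1.2 := by
    unfold unitVec
    exact Measurable.ite (hE (measurableSet_singleton 0)) measurable_const (hE.norm.inv.smul hE)
  have hg : Measurable fun w : (Rd d × Rd d) × (Rd d × ℝ) => w.2.1 := by fun_prop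
  have hp : Measurable fun w : (Rd d × Rd d) × (Rd d × ℝ) =>
      meetProb b F η Δt β w.1.1 w.1.2 w.2.1 := by
    have hφ : Measurable (gaussDensity : Rd d → ℝ) := by
      unfold gaussDensity
      exact Continuous.measurable (by fun_prop)
    have h1 : Measurable fun w : (Rd d × Rd d) × (Rd d × ℝ) =>
        w.2.1 - √(β / (2 * Δt)) • diffVec b F η Δt w.1.1 w.1.2 := hg.sub (hE.fun_const_smul _)
    have h2 : Measurable fun w : (Rd d × Rd d) × (Rd d × ℝ) =>
        gaussDensity (w.2.1 - √(β / (2 * Δt)) • diffVec b F η Δt w.1.1 w.1.2) := hφ.comp h1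
    have h3 : Measurable fun w : (Rd d × Rd d) × (Rd d × ℝ) => gaussDensity w.2.1 := hφ.comp hg
    exact Measurable.min measurable_const (h2.div h3)
  have hX : Measurable fun w : (Rd d × Rd d) × (Rd d × ℝ) => stepX b F η Δt β w.1.1 w.2.1 := by
    unfold stepX
    exact Continuous.measurable (by fun_prop)
  have hY : Measurable fun w : (Rd d × Rd d) × (Rd d × ℝ) =>
      stepReflected b F η Δt β w.1.1 w.1.2 w.2.1 := by
    unfold stepReflected
    have h1 : Measurable fun w : (Rd d × Rd d) × (Rd d × ℝ) => w.1.2 + Δt • b w.1.2 :=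
      Continuous.measurable (by fun_prop)
    have h2 : Measurable fun w : (Rd d × Rd d) × (Rd d × ℝ) =>
        2 * inner ℝ (unitVec b F η Δt w.1.1 w.1.2) w.2.1 := (he.inner hg).const_mul 2
    have h3 : Measurable fun w : (Rd d × Rd d) × (Rd d × ℝ) =>
        w.2.1 - (2 * inner ℝ (unitVec b F η Δt w.1.1 w.1.2) w.2.1) •
          unitVec b F η Δt w.1.1 w.1.2 := hg.fun_sub (h2.fun_smul he)
    exact h1.add (h3.fun_const_smul _)
  unfold step
  exact hX.prodMk (Measurable.ite (measurableSet_le (by fun_prop) hp) hX hY)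

theorem isMarkovKernel_stickyKernel (hb : Continuous b) (hF : Continuous F) :
    IsMarkovKernel (stickyKernel b F η Δt β) := by
  unfold stickyKernel
  exact Kernel.IsMarkovKernel.map _ (measurable_step η Δt β hb hF)

theorem stickyKernel_apply (hb : Continuous b) (hF : Continuous F) (z : Rd d × Rd d) :
    stickyKernel b F η Δt β z = (noiseLaw d).map fun w => step b F η Δt β (z, w) := by
  have hm := measurable_step η Δt β hb hF
  rw [stickyKernel, Kernel.map_apply _ hm, Kernel.prod_apply, Kernel.id_apply, Kernel.const_apply,
    Measure.dirac_prod, Measure.map_map hm (by fun_prop)]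
  rfl

/-- The Lyapunov function `V_c(x, y) = exp (c |x|²) + exp (c |y|²)`. -/
def lyapunov (c : ℝ) (z : Rd d × Rd d) : ℝ :=
  Real.exp (c * ‖z.1‖ ^ 2) + Real.exp (c * ‖z.2‖ ^ 2)

/-- The weighted norm `‖f‖_V = sup_z |f z| / V z`, with values in `[0, ∞]`. -/
def weightedNorm {α : Type*} (V f : α → ℝ) : ℝ≥0∞ :=
  ⨆ z, ENNReal.ofReal (|f z| / V z)

end StickyCoupling

end

/-! The proof applies Harris' theorem, with attention to which constants may depend on `Δt`.

Drift. Each marginal of the sticky coupling is an Euler-Maruyama step: perturbed for the first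
component, unperturbed for the second. For the second, translating the coupled part of the Gaussian
integral by the difference of means and reflecting the rest makes the two weights add up to the
Gaussian density (`lintegral_stickyKernel_snd`). The Lyapunov condition is therefore a one-particle
estimate. Contractivity at infinity shrinks the squared mean by `1 - m Δt`, and an explicit Gaussian
integral turns this into a rate `1 - m Δt / 2` and an additive term of order `Δt`, uniformly in `η`
(`DriftAssumption.exists_lintegral_exp_le`).

Minorization. The coupled part alone already dominates a multiple of a fixed measure on the
diagonal, uniformly in `η` and in starting points from a sublevel set
(`minorConst_smul_diagBall_le`).

Harris. One step contracts the distance to constants in the weight `1 + t V`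
(`exists_abs_integral_sub_le`). The iterates from one point then converge setwise to the invariant
measure, and the bound is `A γ ^ n`, where `A` and `γ` depend on `Δt`.

Uniform prefactor. The drift alone also bounds the error by `1 + K Δt / (1 - r) = 1 + 2 K / m`, free
of `Δt`. Taking a root of `γ` merges the two bounds into one whose prefactor does not see `A`
(`exists_rate_min_le`). -/

noncomputable section

namespace StickyCoupling

/-! ### Setwise limits of probability measures. -/

section Limits

open Filter Topology

variable {α : Type*} [MeasurableSpace α]

/-- A sequence of probability measures that is Cauchy uniformly over measurable sets converges
setwise to a probability measure. -/
theorem exists_isProbabilityMeasure_tendsto_real (μ : ℕ → Measure α)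
    [∀ n, IsProbabilityMeasure (μ n)] (ε : ℕ → ℝ) (hε : Tendsto ε atTop (𝓝 0))
    (h : ∀ n k, n ≤ k → ∀ A, MeasurableSet A → |(μ k).real A - (μ n).real A| ≤ ε n) :
    ∃ ν : Measure α, IsProbabilityMeasure ν ∧
      ∀ A, MeasurableSet A → Tendsto (fun n => (μ n).real A) atTop (𝓝 (ν.real A)) := by
  have hlim : ∀ A, ∃ l : ℝ, MeasurableSet A → Tendsto (fun n => (μ n).real A) atTop (𝓝 l) := by
    intro A
    by_cases hA : MeasurableSet A
    · have hc : CauchySeq fun n => (μ n).real A := by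
        rw [Metric.cauchySeq_iff']
        intro δ hδ
        obtain ⟨n, hn⟩ := (hε.eventually (gt_mem_nhds hδ)).exists
        exact ⟨n, fun k hk => (h n k hk A hA).trans_lt hn⟩
      obtain ⟨l, hl⟩ := cauchySeq_tendsto_of_complete hc
      exact ⟨l, fun _ => hl⟩
    · exact ⟨0, fun h' => absurd h' hA⟩
  choose l hl using hlim
  have hl0 : ∀ A, MeasurableSet A → 0 ≤ l A := fun A hA =>
    ge_of_tendsto' (hl A hA) fun n => measureReal_nonneg
  have hclose : ∀ n A, MeasurableSet A → |l A - (μ n).real A| ≤ ε n := fun n A hA =>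
    le_of_tendsto ((hl A hA).sub_const _).abs <| by
      filter_upwards [eventually_ge_atTop n] with k hk using h n k hk A hA
  -- Countable additivity of the limit is an exchange of limits in `N` and `n`. It is legitimate
  -- because `ε n` bounds the error for all sets at once.
  have hsum : ∀ f : ℕ → Set α, (∀ i, MeasurableSet (f i)) → Pairwise (Function.onFun Disjoint f) →
      HasSum (fun i => l (f i)) (l (⋃ i, f i)) := by
    intro f hf hd
    rw [hasSum_iff_tendsto_nat_of_nonneg (fun i => hl0 _ (hf i))]
    have hfin : ∀ N n, |∑ i ∈ Finset.range N, l (f i) -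
        (μ n).real (⋃ i ∈ Finset.range N, f i)| ≤ ε n := by
      intro N n
      have hm : MeasurableSet (⋃ i ∈ Finset.range N, f i) :=
        Finset.measurableSet_biUnion _ fun i _ => hf i
      have heq : ∀ k, (μ k).real (⋃ i ∈ Finset.range N, f i)
          = ∑ i ∈ Finset.range N, (μ k).real (f i) := fun k =>
        measureReal_biUnion_finset (fun i _ j _ hij => hd hij) (fun i _ => hf i)
      have h1 : Tendsto (fun k => (μ k).real (⋃ i ∈ Finset.range N, f i)) atTop
          (𝓝 (∑ i ∈ Finset.range N, l (f i))) := by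
        simp_rw [heq]
        exact tendsto_finsetSum _ fun i _ => hl _ (hf i)
      rw [tendsto_nhds_unique h1 (hl _ hm)]
      exact hclose n _ hm
    have hcont : ∀ n, Tendsto (fun N => (μ n).real (⋃ i ∈ Finset.range N, f i)) atTop
        (𝓝 ((μ n).real (⋃ i, f i))) := by
      intro n
      have h1 : HasSum (fun i => (μ n).real (f i)) ((μ n).real (⋃ i, f i)) := by
        have h2 := measure_iUnion (μ := μ n) hd hf
        have h3 : ∑' i, (μ n) (f i) ≠ ⊤ := h2 ▸ measure_ne_top _ _
        rw [measureReal_def, h2]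
        rw [ENNReal.tsum_toReal_eq fun i => measure_ne_top _ _]
        exact ENNReal.hasSum_toReal h3
      refine h1.tendsto_sum_nat.congr fun N => ?_
      exact (measureReal_biUnion_finset (fun i _ j _ hij => hd hij) (fun i _ => hf i)).symm
    rw [Metric.tendsto_atTop]
    intro δ hδ
    obtain ⟨n, hn⟩ := (hε.eventually (gt_mem_nhds (by positivity : 0 < δ / 3))).exists
    obtain ⟨N₀, hN⟩ := Metric.tendsto_atTop.1 (hcont n) (δ / 3) (by positivity)
    refine ⟨N₀, fun N hNN => ?_⟩
    have h1 := abs_le.1 (hfin N n)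
    have h2 := abs_lt.1 (Real.dist_eq _ _ ▸ hN N hNN)
    have h3 := abs_le.1 (hclose n _ (MeasurableSet.iUnion hf))
    rw [Real.dist_eq, abs_lt]
    constructor <;> linarith [h1.1, h1.2, h2.1, h2.2, h3.1, h3.2]
  have hempty : l ∅ = 0 := tendsto_nhds_unique (hl ∅ .empty) (by simp)
  let ν : Measure α := Measure.ofMeasurable (fun A _ => ENNReal.ofReal (l A)) (by simp [hempty])
    fun f hf hd => by
      rw [← (hsum f hf hd).tsum_eq,
        ENNReal.ofReal_tsum_of_nonneg (fun i => hl0 _ (hf i)) (hsum f hf hd).summable]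
  have hν : ∀ A, MeasurableSet A → ν A = ENNReal.ofReal (l A) := fun A hA =>
    Measure.ofMeasurable_apply A hA
  have huniv : l Set.univ = 1 := tendsto_nhds_unique (hl _ .univ) (by simp)
  refine ⟨ν, ⟨by rw [hν _ .univ, huniv, ENNReal.ofReal_one]⟩, fun A hA => ?_⟩
  rw [measureReal_def, hν A hA, ENNReal.toReal_ofReal (hl0 A hA)]
  exact hl A hA

/-- Fatou's lemma for setwise convergence. -/
theorem lintegral_le_of_tendsto_real {μ : ℕ → Measure α} [∀ n, IsFiniteMeasure (μ n)]
    {ν : Measure α} [IsFiniteMeasure ν]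
    (h : ∀ A, MeasurableSet A → Tendsto (fun n => (μ n).real A) atTop (𝓝 (ν.real A)))
    {f : α → ℝ≥0∞} {C : ℕ → ℝ≥0∞} {C' : ℝ≥0∞} (hC : ∀ n, ∫⁻ x, f x ∂μ n ≤ C n)
    (hC' : Tendsto C atTop (𝓝 C')) : ∫⁻ x, f x ∂ν ≤ C' := by
  -- Below `f` it suffices to test simple functions with finite values: their integrals are finite
  -- sums of measures, so setwise convergence applies term by term.
  rw [lintegral_eq_nnreal]
  refine iSup₂_le fun g hg => ?_
  have h1 : Tendsto (fun n => (g.map ((↑) : ℝ≥0 → ℝ≥0∞)).lintegral (μ n)) atTop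
      (𝓝 ((g.map ((↑) : ℝ≥0 → ℝ≥0∞)).lintegral ν)) := by
    simp only [SimpleFunc.map_lintegral]
    refine tendsto_finsetSum _ fun x _ => ?_
    refine ENNReal.Tendsto.const_mul ?_ (Or.inr ENNReal.coe_ne_top)
    have := ENNReal.tendsto_ofReal (h _ (g.measurableSet_preimage {x}))
    simpa [measureReal_def, ENNReal.ofReal_toReal, measure_ne_top] using this
  refine le_of_tendsto_of_tendsto' h1 hC' fun n => le_trans ?_ (hC n)
  rw [← SimpleFunc.lintegral_eq_lintegral]
  exact lintegral_mono hg

end Limits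

/-! ### Harris' theorem. -/

section Harris

open Filter Topology

/-- A function whose oscillation is controlled by `h z + h w` lies within `h` of a constant. -/
theorem exists_abs_sub_le_of_sub_le {α : Type*} {g h : α → ℝ}
    (hgh : ∀ z w, g z - g w ≤ h z + h w) : ∃ m, ∀ z, |g z - m| ≤ h z := by
  refine ⟨⨆ z, (g z - h z), fun z => ?_⟩
  have hz : Nonempty α := ⟨z⟩
  have hbdd : BddAbove (Set.range fun z => g z - h z) := by
    refine ⟨g z + h z, ?_⟩
    rintro _ ⟨w, rfl⟩
    have := hgh w z
    dsimp only
    linarith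
  have h1 := le_ciSup hbdd z
  have h2 : ⨆ w, (g w - h w) ≤ g z + h z := ciSup_le fun w => by linarith [hgh w z]
  rw [abs_le]
  constructor <;> linarith

/-- The constants of Harris' theorem: weight and contraction rate. -/
theorem exists_harris_constants {r K a R : ℝ} (hr0 : 0 < r) (hr1 : r < 1) (hK : 0 ≤ K)
    (ha0 : 0 < a) (hR : 2 * K / (1 - r) < R) :
    ∃ t γ : ℝ, 0 < t ∧ 0 < γ ∧ γ < 1 ∧
      (∀ s, R ≤ s → 2 + t * (r * s + 2 * K) ≤ γ * (2 + t * s)) ∧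
      (∀ s, 0 ≤ s → 2 * (1 - a) + t * (r * s + 2 * K) ≤ γ * (2 + t * s)) := by
  have hR0 : 0 ≤ R := le_trans (div_nonneg (by linarith) (by linarith)) hR.le
  have hR' : 2 * K < R * (1 - r) := (div_lt_iff₀ (by linarith)).1 hR
  -- The weight `t` is small enough that the additive drift term costs at most half of the mass `2
  -- a` gained by minorization, which leaves the rate `1 - a / 2`.
  obtain ⟨t, ht, htK⟩ : ∃ t : ℝ, 0 < t ∧ t * (2 * K) ≤ a := by
    refine ⟨a / (2 * K + 1), by positivity, ?_⟩
    rw [div_mul_eq_mul_div, div_le_iff₀ (by positivity)]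
    nlinarith
  have hden : 0 < 2 + t * R := by positivity
  -- The rate needed exactly at `s = R`; it is below `1` because `R` exceeds `2 K / (1 - r)`. Beyond
  -- `R` the slope condition `r ≤ γ` suffices.
  set γ₀ := (2 + t * (r * R + 2 * K)) / (2 + t * R) with hγ₀
  have hγ₀1 : γ₀ < 1 := by
    rw [hγ₀, div_lt_one hden]
    nlinarith
  have hγ₀e : γ₀ * (2 + t * R) = 2 + t * (r * R + 2 * K) := div_mul_cancel₀ _ hden.ne'
  refine ⟨t, max γ₀ (max (1 - a / 2) r), ht, ?_, ?_, fun s hs => ?_, fun s hs => ?_⟩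
  · exact lt_max_of_lt_right (lt_max_of_lt_right hr0)
  · exact max_lt hγ₀1 (max_lt (by linarith) hr1)
  · set γ := max γ₀ (max (1 - a / 2) r)
    have h1 : γ₀ ≤ γ := le_max_left _ _
    have h2 : r ≤ γ := (le_max_right _ _).trans (le_max_right _ _)
    have h3 := mul_le_mul_of_nonneg_right h1 hden.le
    have h4 := mul_nonneg (mul_nonneg ht.le (sub_nonneg.2 hs)) (sub_nonneg.2 h2)
    nlinarith
  · set γ := max γ₀ (max (1 - a / 2) r)
    have h1 : 1 - a / 2 ≤ γ := (le_max_left _ _).trans (le_max_right _ _)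
    have h2 : r ≤ γ := (le_max_right _ _).trans (le_max_right _ _)
    have h3 := mul_le_mul_of_nonneg_left h2 (mul_nonneg ht.le hs)
    nlinarith

variable {α : Type*} [MeasurableSpace α]

theorem integrable_of_lintegral_ofReal_le {μ : Measure α} {V : α → ℝ} (hVm : Measurable V)
    (hV : ∀ z, 0 ≤ V z) {B : ℝ} (h : ∫⁻ w, ENNReal.ofReal (V w) ∂μ ≤ ENNReal.ofReal B) :
    Integrable V μ :=
  ⟨hVm.aestronglyMeasurable, by
    rw [hasFiniteIntegral_iff_ofReal (ae_of_all _ hV)]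
    exact h.trans_lt ENNReal.ofReal_lt_top⟩

theorem integral_le_of_lintegral_ofReal_le {μ : Measure α} {V : α → ℝ} (hVm : Measurable V)
    (hV : ∀ z, 0 ≤ V z) {B : ℝ} (hB : 0 ≤ B)
    (h : ∫⁻ w, ENNReal.ofReal (V w) ∂μ ≤ ENNReal.ofReal B) : ∫ w, V w ∂μ ≤ B := by
  rw [integral_eq_lintegral_of_nonneg_ae (ae_of_all _ hV) hVm.aestronglyMeasurable]
  exact ENNReal.toReal_le_of_le_ofReal hB h

theorem integrable_of_abs_sub_le {μ : Measure α} [IsFiniteMeasure μ] {V φ : α → ℝ}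
    (hV : Integrable V μ) (hφ : Measurable φ) {m S t : ℝ}
    (h : ∀ z, |φ z - m| ≤ S * (1 + t * V z)) : Integrable φ μ := by
  have h1 : Integrable (fun z => φ z - m) μ :=
    Integrable.mono' (((integrable_const 1).add (hV.const_mul t)).const_mul S)
      (hφ.sub_const m).aestronglyMeasurable (ae_of_all _ h)
  exact (h1.add (integrable_const m)).congr (ae_of_all _ fun z => by simp)

/-- The total mass is kept general because the bound is also applied to the remainder of a kernel
after its minorizing part is removed. -/
theorem abs_integral_sub_le {μ : Measure α} [IsFiniteMeasure μ] {V φ : α → ℝ}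
    (hV : Integrable V μ) (hφ : Measurable φ) {m S t : ℝ}
    (h : ∀ z, |φ z - m| ≤ S * (1 + t * V z)) :
    |∫ w, φ w ∂μ - m * μ.real Set.univ| ≤ S * (μ.real Set.univ + t * ∫ w, V w ∂μ) := by
  have hi := integrable_of_abs_sub_le hV hφ h
  have h1 : ∫ w, φ w ∂μ - m * μ.real Set.univ = ∫ w, (φ w - m) ∂μ := by
    rw [integral_sub hi (integrable_const m), integral_const, smul_eq_mul, mul_comm]
  have h2 : S * (μ.real Set.univ + t * ∫ w, V w ∂μ) = ∫ w, S * (1 + t * V w) ∂μ := by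
    rw [integral_const_mul, integral_add (integrable_const _) (hV.const_mul t), integral_const,
      integral_const_mul, smul_eq_mul, mul_one]
  rw [h1, h2]
  exact (abs_integral_le_integral_abs).trans
    (integral_mono (hi.sub (integrable_const m)).abs
      (((integrable_const 1).add (hV.const_mul t)).const_mul S) h)

variable {κ : Kernel α α} [IsMarkovKernel κ] {V : α → ℝ} {r K a R : ℝ} {ν : Measure α}

/-- One step of a kernel with a drift and a minorization condition contracts the weighted
oscillation. -/
theorem exists_abs_integral_sub_le [IsProbabilityMeasure ν] (hVm : Measurable V)
    (hV1 : ∀ z, 1 ≤ V z) (hr0 : 0 < r) (hK : 0 ≤ K) (ha0 : 0 < a)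
    (hdrift : ∀ z, ∫⁻ w, ENNReal.ofReal (V w) ∂κ z ≤ ENNReal.ofReal (r * V z + K))
    (hminor : ∀ z, V z ≤ R → ENNReal.ofReal a • ν ≤ κ z) {t γ : ℝ} (ht : 0 < t)
    (h1 : ∀ s, R ≤ s → 2 + t * (r * s + 2 * K) ≤ γ * (2 + t * s))
    (h2 : ∀ s, 0 ≤ s → 2 * (1 - a) + t * (r * s + 2 * K) ≤ γ * (2 + t * s))
    {φ : α → ℝ} (hφ : Measurable φ) {m S : ℝ} (hS : 0 ≤ S)
    (h : ∀ z, |φ z - m| ≤ S * (1 + t * V z)) :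
    ∃ m', ∀ z, |∫ w, φ w ∂κ z - m'| ≤ γ * S * (1 + t * V z) := by
  have hV0 : ∀ z, 0 ≤ V z := fun z => zero_le_one.trans (hV1 z)
  have hVi : ∀ z, Integrable V (κ z) := fun z =>
    integrable_of_lintegral_ofReal_le hVm hV0 (hdrift z)
  have hVle : ∀ z, ∫ w, V w ∂κ z ≤ r * V z + K := fun z =>
    integral_le_of_lintegral_ofReal_le hVm hV0
      (add_nonneg (mul_nonneg hr0.le (hV0 z)) hK) (hdrift z)
  refine exists_abs_sub_le_of_sub_le fun z w => ?_
  -- For a large sum the drift alone contracts. Otherwise both points lie in the sublevel set, as `V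
  -- ≥ 0`, and the common part `a • ν` cancels in the difference.
  rcases le_total R (V z + V w) with hR | hR
  · have hz := abs_le.1 (abs_integral_sub_le (hVi z) hφ h)
    have hw := abs_le.1 (abs_integral_sub_le (hVi w) hφ h)
    simp only [probReal_univ, mul_one] at hz hw
    have h3 := mul_le_mul_of_nonneg_left (h1 _ hR) hS
    have h4 : S * (t * ∫ x, V x ∂κ z) ≤ S * (t * (r * V z + K)) := by gcongr; exact hVle z
    have h5 : S * (t * ∫ x, V x ∂κ w) ≤ S * (t * (r * V w + K)) := by gcongr; exact hVle w
    linarith [hz.2, hw.1]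
  · have key : ∀ z, V z ≤ R → |∫ x, φ x ∂κ z - a * ∫ x, φ x ∂ν - m * (1 - a)| ≤
        S * ((1 - a) + t * (r * V z + K)) := by
      intro z hz
      have hle := hminor z hz
      have : IsFiniteMeasure (ENNReal.ofReal a • ν) := ν.smul_finite ENNReal.ofReal_ne_top
      set ρ := κ z - ENNReal.ofReal a • ν with hρ
      have hdec : ρ + ENNReal.ofReal a • ν = κ z := Measure.sub_add_cancel_of_le hle
      have hρle : ρ ≤ κ z := Measure.sub_le
      have : IsFiniteMeasure ρ := isFiniteMeasure_of_le _ hρle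
      have hφi : Integrable φ (κ z) := integrable_of_abs_sub_le (hVi z) hφ h
      have hmass : ρ.real Set.univ = 1 - a := by
        have h3 : (κ z).real Set.univ = ρ.real Set.univ + a := by
          rw [← hdec, measureReal_add_apply, measureReal_ennreal_smul_apply]
          simp [ha0.le]
        rw [probReal_univ] at h3
        linarith
      have hint : ∫ x, φ x ∂κ z = ∫ x, φ x ∂ρ + a * ∫ x, φ x ∂ν := by
        have h4 : Integrable φ (ENNReal.ofReal a • ν) := hφi.mono_measure hle
        rw [← hdec, integral_add_measure (hφi.mono_measure hρle) h4, integral_smul_measure,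
          ENNReal.toReal_ofReal ha0.le, smul_eq_mul]
      have h5 := abs_integral_sub_le ((hVi z).mono_measure hρle) hφ h
      rw [hmass] at h5
      have h6 : ∫ x, V x ∂ρ ≤ r * V z + K :=
        (integral_mono_measure hρle (ae_of_all _ hV0) (hVi z)).trans (hVle z)
      rw [hint, add_sub_cancel_right]
      refine h5.trans ?_
      gcongr
    have hz := abs_le.1 (key z (by linarith [hV0 w]))
    have hw := abs_le.1 (key w (by linarith [hV0 z]))
    have h3 := mul_le_mul_of_nonneg_left (h2 _ (add_nonneg (hV0 z) (hV0 w))) hS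
    linarith [hz.2, hw.1]

theorem isMarkovKernel_pow (κ : Kernel α α) [IsMarkovKernel κ] (n : ℕ) :
    IsMarkovKernel (κ ^ n) := by
  induction n with
  | zero => rw [pow_zero]; exact inferInstanceAs (IsMarkovKernel (Kernel.id : Kernel α α))
  | succ n ih => rw [Kernel.pow_add, pow_one]; infer_instance

/-- Induction on `n`: `K / (1 - r)` is the fixed point of `s ↦ r * s + K`. -/
theorem lintegral_pow_le (hVm : Measurable V) (hV1 : ∀ z, 1 ≤ V z) (hr0 : 0 < r) (hr1 : r < 1)
    (hK : 0 ≤ K) (hdrift : ∀ z, ∫⁻ w, ENNReal.ofReal (V w) ∂κ z ≤ ENNReal.ofReal (r * V z + K))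
    (n : ℕ) (z : α) :
    ∫⁻ w, ENNReal.ofReal (V w) ∂(κ ^ n) z ≤ ENNReal.ofReal (V z + K / (1 - r)) := by
  have hK' : 0 ≤ K / (1 - r) := div_nonneg hK (by linarith)
  have hKe : r * (K / (1 - r)) + K = K / (1 - r) := by
    have : 1 - r ≠ 0 := by linarith
    field_simp
    ring
  have hV0 : ∀ z, 0 ≤ V z := fun z => zero_le_one.trans (hV1 z)
  have hVm' : Measurable fun w => ENNReal.ofReal (V w) := hVm.ennreal_ofReal
  induction n with
  | zero =>
    rw [pow_zero]
    change ∫⁻ w, ENNReal.ofReal (V w) ∂(Kernel.id z) ≤ _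
    rw [Kernel.id_apply, lintegral_dirac' z hVm']
    exact ENNReal.ofReal_le_ofReal (by linarith)
  | succ n ih =>
    rw [add_comm, Kernel.pow_add, pow_one, Kernel.lintegral_comp _ _ _ hVm']
    calc ∫⁻ x, ∫⁻ w, ENNReal.ofReal (V w) ∂κ x ∂(κ ^ n) z
        ≤ ∫⁻ x, (ENNReal.ofReal r * ENNReal.ofReal (V x) + ENNReal.ofReal K) ∂(κ ^ n) z := by
          refine lintegral_mono fun x => (hdrift x).trans ?_
          rw [ENNReal.ofReal_add (mul_nonneg hr0.le (hV0 x)) hK, ENNReal.ofReal_mul hr0.le]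
      _ ≤ ENNReal.ofReal r * ENNReal.ofReal (V z + K / (1 - r)) + ENNReal.ofReal K := by
          rw [lintegral_add_right _ measurable_const, lintegral_const_mul _ hVm', lintegral_const]
          have := isMarkovKernel_pow κ n
          simp only [measure_univ, mul_one]
          gcongr
      _ ≤ ENNReal.ofReal (V z + K / (1 - r)) := by
          rw [← ENNReal.ofReal_mul hr0.le, ← ENNReal.ofReal_add
            (mul_nonneg hr0.le (add_nonneg (hV0 z) hK')) hK]
          refine ENNReal.ofReal_le_ofReal ?_
          nlinarith [hV0 z]

/-- The contraction of the weighted oscillation, iterated. -/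
theorem exists_abs_integral_pow_sub_le [IsProbabilityMeasure ν] (hVm : Measurable V)
    (hV1 : ∀ z, 1 ≤ V z) (hr0 : 0 < r) (hr1 : r < 1) (hK : 0 ≤ K) (ha0 : 0 < a)
    (hdrift : ∀ z, ∫⁻ w, ENNReal.ofReal (V w) ∂κ z ≤ ENNReal.ofReal (r * V z + K))
    (hminor : ∀ z, V z ≤ R → ENNReal.ofReal a • ν ≤ κ z) {t γ : ℝ} (ht : 0 < t) (hγ : 0 < γ)
    (h1 : ∀ s, R ≤ s → 2 + t * (r * s + 2 * K) ≤ γ * (2 + t * s))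
    (h2 : ∀ s, 0 ≤ s → 2 * (1 - a) + t * (r * s + 2 * K) ≤ γ * (2 + t * s))
    {φ : α → ℝ} (hφ : Measurable φ) {m S : ℝ} (hS : 0 ≤ S)
    (h : ∀ z, |φ z - m| ≤ S * (1 + t * V z)) (n : ℕ) :
    ∃ m', ∀ z, |∫ w, φ w ∂(κ ^ n) z - m'| ≤ γ ^ n * S * (1 + t * V z) := by
  have hV0 : ∀ z, 0 ≤ V z := fun z => zero_le_one.trans (hV1 z)
  induction n with
  | zero =>
    refine ⟨m, fun z => ?_⟩
    have h0 : (κ ^ 0) z = Measure.dirac z := by rw [pow_zero]; exact Kernel.id_apply z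
    rw [h0, integral_dirac' _ _ hφ.stronglyMeasurable, pow_zero, one_mul]
    exact h z
  | succ n ih =>
    obtain ⟨m', hm'⟩ := ih
    have := isMarkovKernel_pow κ n
    have := isMarkovKernel_pow κ (n + 1)
    have hmeas : Measurable fun z => ∫ w, φ w ∂(κ ^ n) z :=
      (hφ.stronglyMeasurable.integral_kernel (κ := κ ^ n)).measurable
    obtain ⟨m'', hm''⟩ := exists_abs_integral_sub_le hVm hV1 hr0 hK ha0 hdrift hminor ht h1 h2
      hmeas (by positivity) hm'
    refine ⟨m'', fun z => ?_⟩
    have hi : Integrable φ ((κ ^ (n + 1)) z) := integrable_of_abs_sub_le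
      (integrable_of_lintegral_ofReal_le hVm hV0
        (lintegral_pow_le hVm hV1 hr0 hr1 hK hdrift (n + 1) z)) hφ h
    have h3 : ∫ w, φ w ∂(κ ^ (n + 1)) z = ∫ x, ∫ w, φ w ∂(κ ^ n) x ∂κ z := by
      rw [Kernel.pow_add, pow_one] at hi ⊢
      exact Kernel.integral_comp hi
    rw [h3, pow_succ']
    simpa only [mul_assoc] using hm'' z

/-- Harris' theorem: a drift and a minorization condition give a unique invariant probability
measure and geometric convergence in the weighted norm, with constants that depend only on those
of the two conditions. -/
theorem exists_harris (V : α → ℝ) (hVm : Measurable V) (hV1 : ∀ z, 1 ≤ V z) (z₀ : α)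
    {r K a R : ℝ} (hr0 : 0 < r) (hr1 : r < 1) (hK : 0 ≤ K) (ha0 : 0 < a)
    (hR : 2 * K / (1 - r) < R) :
    ∃ γ A : ℝ, 0 < γ ∧ γ < 1 ∧ 0 < A ∧
      ∀ (κ : Kernel α α) (ν : Measure α), IsMarkovKernel κ → IsProbabilityMeasure ν →
        (∀ z, ∫⁻ w, ENNReal.ofReal (V w) ∂κ z ≤ ENNReal.ofReal (r * V z + K)) →
        (∀ z, V z ≤ R → ENNReal.ofReal a • ν ≤ κ z) →
        ∃ μ : Measure α, (IsProbabilityMeasure μ ∧ Kernel.Invariant κ μ) ∧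
          (∀ μ' : Measure α, IsProbabilityMeasure μ' → Kernel.Invariant κ μ' → μ' = μ) ∧
          ∀ φ : α → ℝ, Measurable φ → ∀ B, (∀ z, |φ z| ≤ B * V z) →
            Integrable φ μ ∧ ∀ n : ℕ, (∀ z, Integrable φ ((κ ^ n) z)) ∧
              ∀ N, (∀ z, |φ z - ∫ w, φ w ∂μ| ≤ N * V z) → ∀ z,
                |∫ w, φ w ∂(κ ^ n) z - ∫ w, φ w ∂μ| ≤
                  N * min (A * γ ^ n) (1 + K / (1 - r)) * V z := by
  obtain ⟨t, γ, ht, hγ0, hγ1, h1, h2⟩ := exists_harris_constants hr0 hr1 hK ha0 hR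
  have hK' : 0 ≤ K / (1 - r) := div_nonneg hK (by linarith)
  have hV0 : ∀ z, 0 ≤ V z := fun z => zero_le_one.trans (hV1 z)
  set W := V z₀ + K / (1 - r) with hW
  have hW0 : 0 ≤ W := add_nonneg (hV0 _) hK'
  refine ⟨γ, (2 + t + t * W) / t, hγ0, hγ1, by positivity, ?_⟩
  intro κ ν _ _ hdrift hminor
  have hpow : ∀ n, IsMarkovKernel (κ ^ n) := isMarkovKernel_pow κ
  have hVi : ∀ n z, Integrable V ((κ ^ n) z) := fun n z =>
    integrable_of_lintegral_ofReal_le hVm hV0 (lintegral_pow_le hVm hV1 hr0 hr1 hK hdrift n z)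
  have hVle : ∀ n z, ∫ w, V w ∂(κ ^ n) z ≤ V z + K / (1 - r) := fun n z =>
    integral_le_of_lintegral_ofReal_le hVm hV0 (add_nonneg (hV0 z) hK')
      (lintegral_pow_le hVm hV1 hr0 hr1 hK hdrift n z)
  -- The function `κ ^ n 1_A` is within `γ ^ n (1 + t V)` of a constant. Evaluating it at `z₀` and
  -- averaging it over `κ ^ j z₀` both land near that constant.
  have hcauchy : ∀ n k, n ≤ k → ∀ A, MeasurableSet A →
      |((κ ^ k) z₀).real A - ((κ ^ n) z₀).real A| ≤ γ ^ n * (2 + t * V z₀ + t * W) := by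
    intro n k hnk A hA
    obtain ⟨j, rfl⟩ := Nat.exists_eq_add_of_le hnk
    have hφm : Measurable (A.indicator (fun _ => (1 : ℝ))) := measurable_const.indicator hA
    obtain ⟨m', hm'⟩ := exists_abs_integral_pow_sub_le hVm hV1 hr0 hr1 hK ha0 hdrift hminor ht
      hγ0 h1 h2 hφm (m := 0) zero_le_one (fun z => by
        have h3 : 0 ≤ t * V z := mul_nonneg ht.le (hV0 z)
        by_cases hz : z ∈ A <;> simp [hz] <;> linarith) n
    have hi : Integrable (A.indicator (fun _ => (1 : ℝ))) ((κ ^ (n + j)) z₀) :=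
      (integrable_const 1).indicator hA
    have hmeas : Measurable fun z => ∫ w, A.indicator (fun _ => (1 : ℝ)) w ∂(κ ^ n) z :=
      (hφm.stronglyMeasurable.integral_kernel (κ := κ ^ n)).measurable
    have h3 : ∫ w, A.indicator (fun _ => (1 : ℝ)) w ∂(κ ^ (n + j)) z₀
        = ∫ x, ∫ w, A.indicator (fun _ => (1 : ℝ)) w ∂(κ ^ n) x ∂(κ ^ j) z₀ := by
      rw [Kernel.pow_add] at hi ⊢
      exact Kernel.integral_comp hi
    have h4 := abs_integral_sub_le (hVi j z₀) hmeas hm'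
    rw [← h3, probReal_univ, mul_one] at h4
    have h5 := hm' z₀
    simp only [integral_indicator_const _ hA, smul_eq_mul, mul_one] at h4 h5
    have h6 : γ ^ n * 1 * (1 + t * ∫ w, V w ∂(κ ^ j) z₀) ≤ γ ^ n * 1 * (1 + t * W) := by
      gcongr
      exact hVle j z₀
    rw [abs_le] at h4 h5 ⊢
    constructor <;> nlinarith [h4.1, h4.2, h5.1, h5.2]
  have hγt : Tendsto (fun n : ℕ => γ ^ n) atTop (𝓝 0) :=
    tendsto_pow_atTop_nhds_zero_of_lt_one hγ0.le hγ1
  obtain ⟨μ, hμp, hμ⟩ := exists_isProbabilityMeasure_tendsto_real (fun n => (κ ^ n) z₀) _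
    (by simpa using hγt.mul_const (2 + t * V z₀ + t * W)) hcauchy
  have hVμ : ∫⁻ w, ENNReal.ofReal (V w) ∂μ ≤ ENNReal.ofReal W :=
    lintegral_le_of_tendsto_real hμ
      (fun n => lintegral_pow_le hVm hV1 hr0 hr1 hK hdrift n z₀) tendsto_const_nhds
  have hVμi : Integrable V μ := integrable_of_lintegral_ofReal_le hVm hV0 hVμ
  have hVμle : ∫ w, V w ∂μ ≤ W := integral_le_of_lintegral_ofReal_le hVm hV0 hW0 hVμ
  have hinv : Kernel.Invariant κ μ := by
    -- Fatou gives only one inequality between `μ κ` and `μ`; equal total masses upgrade it to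
    -- equality.
    refine Measure.eq_of_le_of_measure_univ_eq ?_ (by simp)
    refine Measure.le_iff.2 fun A hA => ?_
    rw [Measure.bind_apply hA κ.aemeasurable]
    refine lintegral_le_of_tendsto_real hμ (C := fun n => (κ ^ (n + 1)) z₀ A) (fun n => ?_) ?_
    · rw [Kernel.pow_succ_apply_eq_lintegral _ _ _ hA]
    · have h3 := ENNReal.tendsto_ofReal ((hμ A hA).comp (tendsto_add_atTop_nat 1))
      simpa [Function.comp_def, measureReal_def, ENNReal.ofReal_toReal, measure_ne_top] using h3
  have hinvn : ∀ {μ' : Measure α}, Kernel.Invariant κ μ' → ∀ n, Kernel.Invariant (κ ^ n) μ' := by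
    intro μ' hμ' n
    induction n with
    | zero => rw [pow_zero]; exact Measure.bind_dirac
    | succ n ih => rw [Kernel.pow_add, pow_one]; exact Kernel.Invariant.comp ih hμ'
  have hgeo : ∀ φ : α → ℝ, Measurable φ → ∀ N, (∀ z, |φ z - ∫ w, φ w ∂μ| ≤ N * V z) → ∀ n z,
      |∫ w, φ w ∂(κ ^ n) z - ∫ w, φ w ∂μ| ≤ N * ((2 + t + t * W) / t * γ ^ n) * V z := by
    intro φ hφ N hN n z
    have hN0 : 0 ≤ N := nonneg_of_mul_nonneg_left ((abs_nonneg _).trans (hN z))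
      (zero_lt_one.trans_le (hV1 z))
    obtain ⟨m', hm'⟩ := exists_abs_integral_pow_sub_le hVm hV1 hr0 hr1 hK ha0 hdrift hminor ht
      hγ0 h1 h2 hφ (m := ∫ w, φ w ∂μ) (div_nonneg hN0 ht.le) (fun z => (hN z).trans (by
        have : N / t * (1 + t * V z) = N / t + N * V z := by field_simp
        rw [this]
        linarith [div_nonneg hN0 ht.le])) n
    have hmeas : Measurable fun z => ∫ w, φ w ∂(κ ^ n) z :=
      (hφ.stronglyMeasurable.integral_kernel (κ := κ ^ n)).measurable
    have hφi : Integrable φ μ := integrable_of_abs_sub_le (t := 1) hVμi hφ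
      (m := ∫ w, φ w ∂μ) (S := N) fun z => (hN z).trans (by nlinarith)
    have h4 := abs_integral_sub_le hVμi hmeas hm'
    -- By invariance, averaging the bound over `μ` compares the unknown constant `m'` with `μ φ`.
    have h5 : ∫ z, ∫ w, φ w ∂(κ ^ n) z ∂μ = ∫ w, φ w ∂μ := by
      have h6 := (hinvn hinv n).def
      conv_rhs => rw [← h6]
      rw [← h6] at hφi
      exact (Kernel.integral_comp (κ := Kernel.const α μ) (η := κ ^ n) (a := z) hφi).symm
    rw [h5, probReal_univ, mul_one] at h4
    have h7 := hm' z
    have h8 : γ ^ n * (N / t) * (1 + t * ∫ w, V w ∂μ) ≤ γ ^ n * (N / t) * (1 + t * W) := by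
      gcongr
    have h9 : γ ^ n * (N / t) * (2 + t * W) ≤ γ ^ n * (N / t) * ((2 + t * W) * V z) := by
      gcongr
      nlinarith [hV1 z, mul_nonneg ht.le hW0]
    have h10 : N * ((2 + t + t * W) / t * γ ^ n) * V z
        = γ ^ n * (N / t) * ((2 + t * W) * V z) + γ ^ n * (N / t) * (t * V z) := by
      field_simp
      ring
    rw [h10]
    rw [abs_le] at h4 h7 ⊢
    constructor <;> nlinarith [h4.1, h4.2, h7.1, h7.2]
  refine ⟨μ, ⟨hμp, hinv⟩, fun μ' hμ'p hμ' => ?_, fun φ hφ B hB => ?_⟩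
  · refine Measure.ext fun A hA => ?_
    have hφm : Measurable (A.indicator (fun _ => (1 : ℝ))) := measurable_const.indicator hA
    have hlim : ∀ z, Tendsto (fun n => ((κ ^ n) z).real A) atTop (𝓝 (μ.real A)) := by
      intro z
      have h3 := hgeo _ hφm 1 (fun w => by
        rw [integral_indicator_const _ hA, smul_eq_mul, mul_one, one_mul]
        have h4 : μ.real A ≤ 1 := measureReal_le_one
        have h5 : 0 ≤ μ.real A := measureReal_nonneg
        refine le_trans ?_ (hV1 w)
        by_cases hw : w ∈ A <;> simp [hw, abs_le] <;> linarith)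
      rw [tendsto_iff_dist_tendsto_zero]
      refine squeeze_zero (fun _ => dist_nonneg) (fun n => ?_)
        (g := fun n => 1 * ((2 + t + t * W) / t * γ ^ n) * V z)
        (by simpa using ((hγt.const_mul ((2 + t + t * W) / t)).const_mul 1).mul_const (V z))
      have h4 := h3 n z
      simpa only [integral_indicator_const _ hA, smul_eq_mul, mul_one, Real.dist_eq] using h4
    -- Indicators are bounded by `1`, so dominated convergence works for every invariant `μ'`, with
    -- no integrability of `V` under `μ'`.
    have h3 : Tendsto (fun n => ∫ z, ((κ ^ n) z).real A ∂μ') atTop (𝓝 (∫ z, μ.real A ∂μ')) := by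
      refine tendsto_integral_of_dominated_convergence (fun _ => 1) (fun n => ?_)
        (integrable_const 1) (fun n => ae_of_all _ fun z => ?_) (ae_of_all _ hlim)
      · exact ((κ ^ n).measurable_coe hA).ennreal_toReal.aestronglyMeasurable
      · rw [Real.norm_eq_abs, abs_of_nonneg measureReal_nonneg]
        exact measureReal_le_one
    have h4 : ∀ n, ∫ z, ((κ ^ n) z).real A ∂μ' = μ'.real A := by
      intro n
      simp only [measureReal_def]
      rw [integral_toReal ((κ ^ n).measurable_coe hA).aemeasurable
        (ae_of_all _ fun z => measure_lt_top _ _),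
        ← Measure.bind_apply hA (κ ^ n).aemeasurable, (hinvn hμ' n).def]
    simp only [h4, integral_const, probReal_univ, one_smul] at h3
    have h5 := tendsto_nhds_unique h3 tendsto_const_nhds
    rw [measureReal_def, measureReal_def, ENNReal.toReal_eq_toReal_iff' (measure_ne_top _ _)
      (measure_ne_top _ _)] at h5
    exact h5.symm
  · have hφi : ∀ {μ' : Measure α} [IsFiniteMeasure μ'], Integrable V μ' → Integrable φ μ' :=
      fun h => Integrable.mono' (h.const_mul B) hφ.aestronglyMeasurable (ae_of_all _ hB)
    refine ⟨hφi hVμi, fun n => ⟨fun z => hφi (hVi n z), fun N hN z => ?_⟩⟩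
    have hN0 : 0 ≤ N := nonneg_of_mul_nonneg_left ((abs_nonneg _).trans (hN z))
      (zero_lt_one.trans_le (hV1 z))
    rw [mul_min_of_nonneg _ _ hN0, min_mul_of_nonneg _ _ (hV0 z)]
    -- The second bound uses only the drift and does not involve `A`, `t` or `a`.
    refine le_min (hgeo φ hφ N hN n z) ?_
    have h3 : ∫ w, φ w ∂(κ ^ n) z - ∫ w, φ w ∂μ
        = ∫ w, (φ w - ∫ w, φ w ∂μ) ∂(κ ^ n) z := by
      rw [integral_sub (hφi (hVi n z)) (integrable_const _), integral_const, probReal_univ,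
        one_smul]
    calc |∫ w, φ w ∂(κ ^ n) z - ∫ w, φ w ∂μ|
        ≤ ∫ w, |φ w - ∫ w, φ w ∂μ| ∂(κ ^ n) z := h3 ▸ abs_integral_le_integral_abs
      _ ≤ ∫ w, N * V w ∂(κ ^ n) z :=
          integral_mono ((hφi (hVi n z)).sub (integrable_const _)).abs ((hVi n z).const_mul N) hN
      _ = N * ∫ w, V w ∂(κ ^ n) z := integral_const_mul _ _
      _ ≤ N * (V z + K / (1 - r)) := by gcongr; exact hVle n z
      _ ≤ N * (1 + K / (1 - r)) * V z := by
          rw [mul_assoc]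
          gcongr
          nlinarith [hV1 z]

end Harris

/-! ### Gaussian density and exponential moments. -/

section Gaussian

variable {d : ℕ}

theorem gaussDensity_pos (g : Rd d) : 0 < gaussDensity g := by
  unfold gaussDensity
  positivity

theorem continuous_gaussDensity : Continuous (gaussDensity : Rd d → ℝ) := by
  unfold gaussDensity
  fun_prop

theorem gaussDensity_congr {g h : Rd d} (hgh : ‖g‖ = ‖h‖) : gaussDensity g = gaussDensity h := by
  unfold gaussDensity
  rw [hgh]

theorem integrable_exp_neg_mul_sq_norm_add {q : ℝ} (hq : 0 < q) (w : Rd d) :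
    Integrable fun v : Rd d => Real.exp (-q * ‖v‖ ^ 2 + inner ℝ w v) := by
  have h := (GaussianFourier.integrable_cexp_neg_mul_sq_norm_add (V := Rd d) (b := (q : ℂ))
    (by simpa using hq) 1 w).re
  refine h.congr (ae_of_all _ fun v => ?_)
  dsimp only
  rw [← Complex.exp_ofReal_re]
  simp

theorem integral_exp_neg_mul_sq_norm_add {q : ℝ} (hq : 0 < q) (w : Rd d) :
    ∫ v : Rd d, Real.exp (-q * ‖v‖ ^ 2 + inner ℝ w v) =
      (Real.pi / q) ^ ((d : ℝ) / 2) * Real.exp (‖w‖ ^ 2 / (4 * q)) := by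
  have h := GaussianFourier.integral_cexp_neg_mul_sq_norm_add (V := Rd d) (b := (q : ℂ))
    (by simpa using hq) 1 w
  rw [← Complex.ofReal_inj, ← integral_complex_ofReal]
  convert h using 1
  · congr 1
    ext v
    push_cast
    simp
  · push_cast [Complex.ofReal_cpow (div_pos Real.pi_pos hq).le]
    simp

/-- Both measures are finite and have the same characteristic function. -/
theorem stdGaussian_eq_withDensity :
    stdGaussian (Rd d) = volume.withDensity fun g => ENNReal.ofReal (gaussDensity g) := by
  have hm : Measurable fun g : Rd d => ENNReal.ofReal (gaussDensity g) :=
    continuous_gaussDensity.measurable.ennreal_ofReal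
  have hi : Integrable (gaussDensity : Rd d → ℝ) := by
    have h := (integrable_exp_neg_mul_sq_norm_add (d := d) (q := 1 / 2) (by norm_num) 0).const_mul
      ((2 * Real.pi) ^ (-(d : ℝ) / 2))
    refine h.congr (ae_of_all _ fun v => ?_)
    simp only [inner_zero_left, gaussDensity]
    congr 2
    ring
  have : IsFiniteMeasure (volume.withDensity fun g : Rd d => ENNReal.ofReal (gaussDensity g)) :=
    isFiniteMeasure_withDensity_ofReal hi.2
  refine Measure.ext_of_charFun (funext fun t => ?_)
  rw [charFun_stdGaussian, charFun_apply, integral_withDensity_eq_integral_toReal_smul hm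
    (ae_of_all _ fun _ => ENNReal.ofReal_lt_top)]
  have h := GaussianFourier.integral_cexp_neg_mul_sq_norm_add (V := Rd d) (b := (1 / 2 : ℂ))
    (by norm_num) Complex.I t
  have h1 : ∀ x : Rd d, (ENNReal.ofReal (gaussDensity x)).toReal •
      Complex.exp (inner ℝ x t * Complex.I) = (((2 * Real.pi) ^ (-(d : ℝ) / 2) : ℝ) : ℂ) *
        Complex.exp (-(1 / 2 : ℂ) * ‖x‖ ^ 2 + Complex.I * inner ℝ t x) := by
    intro x
    rw [ENNReal.toReal_ofReal (gaussDensity_pos x).le, Complex.real_smul, gaussDensity,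
      Complex.ofReal_mul, Complex.ofReal_exp, mul_assoc, ← Complex.exp_add, real_inner_comm]
    congr 2
    push_cast
    ring
  simp_rw [h1]
  rw [integral_const_mul, h, ← mul_assoc]
  have h2 : (((2 * Real.pi) ^ (-(d : ℝ) / 2) : ℝ) : ℂ) *
      ((Real.pi : ℂ) / (1 / 2)) ^ ((Module.finrank ℝ (Rd d) : ℂ) / 2) = 1 := by
    have h3 : ((Real.pi : ℂ) / (1 / 2)) ^ ((Module.finrank ℝ (Rd d) : ℂ) / 2)
        = (((2 * Real.pi) ^ ((d : ℝ) / 2) : ℝ) : ℂ) := by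
      rw [Complex.ofReal_cpow (by positivity)]
      push_cast
      congr 1
      · ring
      · simp
    rw [h3, ← Complex.ofReal_mul, ← Real.rpow_add (by positivity), neg_div, neg_add_cancel,
      Real.rpow_zero, Complex.ofReal_one]
  rw [h2, one_mul, Complex.I_sq]
  congr 1
  ring

theorem lintegral_stdGaussian {f : Rd d → ℝ≥0∞} (hf : Measurable f) :
    ∫⁻ g, f g ∂(stdGaussian (Rd d)) = ∫⁻ g, ENNReal.ofReal (gaussDensity g) * f g := by
  rw [stdGaussian_eq_withDensity, lintegral_withDensity_eq_lintegral_mul _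
    continuous_gaussDensity.measurable.ennreal_ofReal hf]
  rfl

/-- The exponential moment of the squared norm of a Gaussian vector. -/
theorem lintegral_exp_sq_norm_stdGaussian {c σ q : ℝ} (hq : 0 < q) (hqe : q = 1 - 2 * c * σ ^ 2)
    (w : Rd d) :
    ∫⁻ g, ENNReal.ofReal (Real.exp (c * ‖w + σ • g‖ ^ 2)) ∂(stdGaussian (Rd d)) =
      ENNReal.ofReal (q ^ (-(d : ℝ) / 2) * Real.exp (c * ‖w‖ ^ 2 / q)) := by
  have hq2 : 0 < q / 2 := by positivity
  rw [lintegral_stdGaussian (Continuous.measurable (by fun_prop)).ennreal_ofReal]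
  -- The coefficient of `‖g‖ ^ 2` in the exponent is `c σ² - 1 / 2 = -q / 2`.
  have h1 : ∀ g : Rd d, ENNReal.ofReal (gaussDensity g) *
      ENNReal.ofReal (Real.exp (c * ‖w + σ • g‖ ^ 2)) =
      ENNReal.ofReal ((2 * Real.pi) ^ (-(d : ℝ) / 2) * Real.exp (c * ‖w‖ ^ 2)) *
        ENNReal.ofReal (Real.exp (-(q / 2) * ‖g‖ ^ 2 + inner ℝ ((2 * c * σ) • w) g)) := by
    intro g
    rw [← ENNReal.ofReal_mul (gaussDensity_pos g).le, ← ENNReal.ofReal_mul (by positivity),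
      gaussDensity, mul_assoc, mul_assoc, ← Real.exp_add, ← Real.exp_add, norm_add_sq_real,
      real_inner_smul_right, real_inner_smul_left, norm_smul, mul_pow, Real.norm_eq_abs, sq_abs,
      hqe]
    congr 3
    ring
  simp_rw [h1]
  rw [lintegral_const_mul _ (Continuous.measurable (by fun_prop)).ennreal_ofReal,
    ← ofReal_integral_eq_lintegral_ofReal (integrable_exp_neg_mul_sq_norm_add hq2 _)
      (ae_of_all _ fun _ => (Real.exp_pos _).le),
    integral_exp_neg_mul_sq_norm_add hq2, ← ENNReal.ofReal_mul (by positivity)]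
  have h2 : (2 * Real.pi) ^ (-(d : ℝ) / 2) * (Real.pi / (q / 2)) ^ ((d : ℝ) / 2)
      = q ^ (-(d : ℝ) / 2) := by
    have hpi : 0 ≤ 2 * Real.pi := by positivity
    rw [show Real.pi / (q / 2) = (2 * Real.pi) * q⁻¹ by field_simp,
      Real.mul_rpow hpi (by positivity : 0 ≤ q⁻¹), ← mul_assoc, ← Real.rpow_add (by positivity),
      neg_div, neg_add_cancel, Real.rpow_zero, one_mul, Real.inv_rpow hq.le, Real.rpow_neg hq.le]
  have h3 : c * ‖w‖ ^ 2 + ‖(2 * c * σ) • w‖ ^ 2 / (4 * (q / 2)) = c * ‖w‖ ^ 2 / q := by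
    rw [norm_smul, mul_pow, Real.norm_eq_abs, sq_abs]
    field_simp
    rw [hqe]
    ring
  rw [← h2, ← h3, Real.exp_add]
  congr 1
  ring

end Gaussian

/-! ### One-step integrals and marginals of the sticky kernel. -/

section Kernel

theorem setLIntegral_Icc_ite_le {p : ℝ} (hp0 : 0 ≤ p) (hp1 : p ≤ 1) (A B : ℝ≥0∞) :
    ∫⁻ u in Set.Icc (0 : ℝ) 1, (open Classical in if u ≤ p then A else B) =
      ENNReal.ofReal p * A + ENNReal.ofReal (1 - p) * B := by
  have hs : MeasurableSet {u : ℝ | u ≤ p} := measurableSet_Iic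
  have h1 : ∀ u : ℝ, (open Classical in if u ≤ p then A else B) =
      {u : ℝ | u ≤ p}.indicator (fun _ => A) u + {u : ℝ | u ≤ p}ᶜ.indicator (fun _ => B) u := by
    intro u
    by_cases hu : u ≤ p <;> simp [hu]
  simp_rw [h1]
  rw [lintegral_add_left (measurable_const.indicator hs), lintegral_indicator_const hs,
    lintegral_indicator_const hs.compl, Measure.restrict_apply hs,
    Measure.restrict_apply hs.compl]
  have h2 : {u : ℝ | u ≤ p} ∩ Set.Icc 0 1 = Set.Icc 0 p := by
    ext u
    simp only [Set.mem_inter_iff, Set.mem_ofPred_eq, Set.mem_Icc]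
    constructor
    · rintro ⟨h, h', -⟩
      exact ⟨h', h⟩
    · rintro ⟨h, h'⟩
      exact ⟨h', h, h'.trans hp1⟩
  have h3 : {u : ℝ | u ≤ p}ᶜ ∩ Set.Icc 0 1 = Set.Ioc p 1 := by
    ext u
    simp only [Set.mem_inter_iff, Set.mem_compl_iff, Set.mem_ofPred_eq, Set.mem_Icc, Set.mem_Ioc,
      not_le]
    constructor
    · rintro ⟨h, -, h'⟩
      exact ⟨h, h'⟩
    · rintro ⟨h, h'⟩
      exact ⟨h, hp0.trans h.le, h'⟩
  rw [h2, h3, Real.volume_Icc, Real.volume_Ioc, sub_zero, mul_comm A, mul_comm B]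

variable {d : ℕ} {b F : Rd d → Rd d} {η Δt β : ℝ}

theorem meetProb_mem_Icc (x y g : Rd d) : meetProb b F η Δt β x y g ∈ Set.Icc (0 : ℝ) 1 :=
  ⟨le_min zero_le_one (div_pos (gaussDensity_pos _) (gaussDensity_pos _)).le, min_le_left _ _⟩

/-- Removes the quotient of densities: the coupled mass is the overlap of two Gaussians. -/
theorem gaussDensity_mul_meetProb (x y g : Rd d) :
    gaussDensity g * meetProb b F η Δt β x y g = min (gaussDensity g)
      (gaussDensity (g - √(β / (2 * Δt)) • diffVec b F η Δt x y)) := by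
  have h := gaussDensity_pos g
  rw [meetProb, mul_min_of_nonneg _ _ h.le, mul_one, mul_div_cancel₀ _ h.ne']

theorem unitVec_eq (x y : Rd d) :
    unitVec b F η Δt x y = ‖diffVec b F η Δt x y‖⁻¹ • diffVec b F η Δt x y := by
  unfold unitVec
  split_ifs with h
  · simp [h]
  · rfl

theorem measurable_stepX (x : Rd d) : Measurable (stepX b F η Δt β x) :=
  Continuous.measurable (by unfold stepX; fun_prop)

theorem measurable_stepReflected (x y : Rd d) : Measurable (stepReflected b F η Δt β x y) :=
  Continuous.measurable (by unfold stepReflected; fun_prop)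

theorem measurable_meetProb (x y : Rd d) : Measurable (meetProb b F η Δt β x y) := by
  unfold meetProb
  have h := continuous_gaussDensity (d := d)
  exact measurable_const.min ((Continuous.measurable (by fun_prop)).div h.measurable)

/-- Integrating out the uniform variable splits the Gaussian weight into the overlap, carried by the
diagonal, and the remainder, carried by the reflected move. -/
theorem lintegral_stickyKernel (hb : Continuous b) (hF : Continuous F) (z : Rd d × Rd d)
    {f : Rd d × Rd d → ℝ≥0∞} (hf : Measurable f) :
    ∫⁻ w, f w ∂(stickyKernel b F η Δt β z) = ∫⁻ g,
      (ENNReal.ofReal (min (gaussDensity g)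
          (gaussDensity (g - √(β / (2 * Δt)) • diffVec b F η Δt z.1 z.2))) *
            f (stepX b F η Δt β z.1 g, stepX b F η Δt β z.1 g) +
        ENNReal.ofReal (gaussDensity g - min (gaussDensity g)
          (gaussDensity (g - √(β / (2 * Δt)) • diffVec b F η Δt z.1 z.2))) *
            f (stepX b F η Δt β z.1 g, stepReflected b F η Δt β z.1 z.2 g)) := by
  have hstep : Measurable fun w => step b F η Δt β (z, w) :=
    (measurable_step η Δt β hb hF).comp measurable_prodMk_left
  have hX := measurable_stepX (b := b) (F := F) (η := η) (Δt := Δt) (β := β) z.1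
  have hY := measurable_stepReflected (b := b) (F := F) (η := η) (Δt := Δt) (β := β) z.1 z.2
  have hp := measurable_meetProb (b := b) (F := F) (η := η) (Δt := Δt) (β := β) z.1 z.2
  rw [stickyKernel_apply η Δt β hb hF, lintegral_map hf hstep, noiseLaw,
    lintegral_prod (fun w => f (step b F η Δt β (z, w))) (hf.comp hstep).aemeasurable]
  have h1 : ∀ g, ∫⁻ u in Set.Icc (0 : ℝ) 1, f (step b F η Δt β (z, (g, u))) =
      ENNReal.ofReal (meetProb b F η Δt β z.1 z.2 g) *
        f (stepX b F η Δt β z.1 g, stepX b F η Δt β z.1 g) +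
      ENNReal.ofReal (1 - meetProb b F η Δt β z.1 z.2 g) *
        f (stepX b F η Δt β z.1 g, stepReflected b F η Δt β z.1 z.2 g) := by
    intro g
    have hpg := meetProb_mem_Icc (b := b) (F := F) (η := η) (Δt := Δt) (β := β) z.1 z.2 g
    rw [← setLIntegral_Icc_ite_le hpg.1 hpg.2]
    refine lintegral_congr fun u => ?_
    unfold step
    dsimp only
    split_ifs <;> rfl
  simp_rw [h1]
  rw [lintegral_stdGaussian]
  · refine lintegral_congr fun g => ?_
    have hpg := meetProb_mem_Icc (b := b) (F := F) (η := η) (Δt := Δt) (β := β) z.1 z.2 g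
    rw [← gaussDensity_mul_meetProb, mul_add, ← mul_assoc, ← mul_assoc,
      ← ENNReal.ofReal_mul (gaussDensity_pos g).le, ← ENNReal.ofReal_mul (gaussDensity_pos g).le,
      mul_sub, mul_one]
  · exact (hp.ennreal_ofReal.mul (hf.comp (hX.prodMk hX))).add
      ((measurable_const.sub hp).ennreal_ofReal.mul (hf.comp (hX.prodMk hY)))

/-- The law of the first component after one step. -/
theorem lintegral_stickyKernel_fst (hb : Continuous b) (hF : Continuous F) (z : Rd d × Rd d)
    {h : Rd d → ℝ≥0∞} (hh : Measurable h) :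
    ∫⁻ w, h w.1 ∂(stickyKernel b F η Δt β z) =
      ∫⁻ g, h (z.1 + Δt • (b z.1 + η • F z.1) + √(2 * Δt / β) • g) ∂(stdGaussian (Rd d)) := by
  rw [lintegral_stickyKernel hb hF z (f := fun w => h w.1) (hh.comp measurable_fst),
    lintegral_stdGaussian
      (f := fun g => h (z.1 + Δt • (b z.1 + η • F z.1) + √(2 * Δt / β) • g))
      (hh.comp (measurable_stepX z.1))]
  refine lintegral_congr fun g => ?_
  rw [← add_mul, ← ENNReal.ofReal_add (le_min (gaussDensity_pos _).le (gaussDensity_pos _).le)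
    (sub_nonneg.2 (min_le_left _ _)), add_sub_cancel]
  rfl

/-- The reflection `g ↦ g - 2 ⟨e, g⟩ e` with `e = v / |v|`, as a linear isometry. -/
def reflectionEquiv (v : Rd d) : Rd d ≃ₗᵢ[ℝ] Rd d :=
  (Submodule.reflection (Submodule.span ℝ {v})).trans (LinearIsometryEquiv.neg ℝ)

theorem reflectionEquiv_apply (v g : Rd d) :
    reflectionEquiv v g = g - (2 * inner ℝ (‖v‖⁻¹ • v) g) • (‖v‖⁻¹ • v) := by
  have h := Submodule.reflection_singleton_apply (𝕜 := ℝ) v g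
  rw [reflectionEquiv, LinearIsometryEquiv.trans_apply, h]
  simp only [LinearIsometryEquiv.coe_neg, neg_sub, real_inner_smul_left, smul_smul]
  congr 1
  rw [two_smul, ← add_smul]
  congr 1
  simp
  ring

/-- The law of the second component after one step. -/
theorem lintegral_stickyKernel_snd (hΔt : 0 < Δt) (hβ : 0 < β) (hb : Continuous b)
    (hF : Continuous F) (z : Rd d × Rd d) {h : Rd d → ℝ≥0∞} (hh : Measurable h) :
    ∫⁻ w, h w.2 ∂(stickyKernel b F η Δt β z) =
      ∫⁻ g, h (z.2 + Δt • b z.2 + √(2 * Δt / β) • g) ∂(stdGaussian (Rd d)) := by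
  set σ := √(2 * Δt / β) with hσ
  set D := diffVec b F η Δt z.1 z.2 with hD
  set e := √(β / (2 * Δt)) • D with he
  have hσe : σ • e = D := by
    rw [he, smul_smul, hσ, ← Real.sqrt_mul (by positivity),
      show 2 * Δt / β * (β / (2 * Δt)) = 1 by field_simp, Real.sqrt_one, one_smul]
  have hφ : Measurable (gaussDensity : Rd d → ℝ) := continuous_gaussDensity.measurable
  have hmin : Measurable fun g : Rd d => min (gaussDensity g) (gaussDensity (g - e)) :=
    hφ.min (hφ.comp (measurable_id.sub_const e))
  have hX := measurable_stepX (b := b) (F := F) (η := η) (Δt := Δt) (β := β) z.1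
  have hY := measurable_stepReflected (b := b) (F := F) (η := η) (Δt := Δt) (β := β) z.1 z.2
  have hv : Measurable fun g : Rd d => z.2 + Δt • b z.2 + σ • g :=
    Continuous.measurable (by fun_prop)
  rw [lintegral_stickyKernel hb hF z (f := fun w => h w.2) (hh.comp measurable_snd),
    lintegral_stdGaussian (f := fun g => h (z.2 + Δt • b z.2 + σ • g)) (hh.comp hv)]
  dsimp only
  -- Translate by `e` in the coupled term and reflect in the other. Both then evaluate `h` at the
  -- same point.
  rw [lintegral_add_left (f := fun g => ENNReal.ofReal (min (gaussDensity g)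
      (gaussDensity (g - e))) * h (stepX b F η Δt β z.1 g))
      (hmin.ennreal_ofReal.mul (hh.comp hX)),
    ← lintegral_add_right_eq_self _ e,
    ← (reflectionEquiv D).measurePreserving.lintegral_comp
      (f := fun g => ENNReal.ofReal (gaussDensity g - min (gaussDensity g)
        (gaussDensity (g - e))) * h (stepReflected b F η Δt β z.1 z.2 g))
      ((hφ.sub hmin).ennreal_ofReal.mul (hh.comp hY)),
    ← lintegral_add_left]
  · refine lintegral_congr fun g => ?_
    have h1 : stepX b F η Δt β z.1 (g + e) = z.2 + Δt • b z.2 + σ • g := by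
      rw [stepX, ← hσ, smul_add σ, hσe, hD, diffVec]
      module
    have h2 : stepReflected b F η Δt β z.1 z.2 (reflectionEquiv D g)
        = z.2 + Δt • b z.2 + σ • g := by
      rw [stepReflected, unitVec_eq, ← hD, ← reflectionEquiv_apply]
      congr 2
      simp [reflectionEquiv]
    -- The reflection sends `e` to `-e`, so the overlap subtracted in the second term is the one
    -- produced by the translation in the first.
    have h3 : gaussDensity (reflectionEquiv D g - e) = gaussDensity (g + e) := by
      refine gaussDensity_congr ?_
      have h4 : reflectionEquiv D e = -e := by
        simp only [reflectionEquiv, LinearIsometryEquiv.trans_apply, LinearIsometryEquiv.coe_neg,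
          he, map_smul]
        rw [Submodule.reflection_mem_subspace_eq_self (Submodule.mem_span_singleton_self D),
          smul_neg]
      rw [sub_eq_add_neg, ← h4, ← map_add, LinearIsometryEquiv.norm_map]
    rw [h1, h2, h3, gaussDensity_congr ((reflectionEquiv D).norm_map g), add_sub_cancel_right,
      ← add_mul, min_comm (gaussDensity (g + e)), ← ENNReal.ofReal_add
        (le_min (gaussDensity_pos _).le (gaussDensity_pos _).le)
        (sub_nonneg.2 (min_le_left _ _)), add_sub_cancel]
  · exact (hmin.ennreal_ofReal.mul (hh.comp hX)).comp (measurable_id.add_const e)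

end Kernel

/-! ### Minorization by a measure on the diagonal. -/

section Minorization

variable {d : ℕ} {b F : Rd d → Rd d} {η Δt β : ℝ}

/-- The law of `(σ G, σ G)` for `G` uniform on the unit ball. -/
def diagBall (d : ℕ) (σ : ℝ) : Measure (Rd d × Rd d) :=
  (cond volume (Metric.ball (0 : Rd d) 1)).map fun g => (σ • g, σ • g)

theorem isProbabilityMeasure_diagBall (d : ℕ) (σ : ℝ) : IsProbabilityMeasure (diagBall d σ) := by
  have : IsProbabilityMeasure (cond volume (Metric.ball (0 : Rd d) 1)) :=
    cond_isProbabilityMeasure_of_finite (Metric.measure_ball_pos _ _ one_pos).ne'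
      measure_ball_lt_top.ne
  exact Measure.isProbabilityMeasure_map (Continuous.aemeasurable (by fun_prop))

/-- Lower bound of the Gaussian density on the ball of radius `1 + ρ`, times the volume of the unit
ball. -/
def minorConst (d : ℕ) (ρ : ℝ) : ℝ :=
  (2 * Real.pi) ^ (-(d : ℝ) / 2) * Real.exp (-(1 + ρ) ^ 2 / 2) *
    (volume (Metric.ball (0 : Rd d) 1)).toReal

theorem minorConst_pos (d : ℕ) (ρ : ℝ) : 0 < minorConst d ρ := by
  have := ENNReal.toReal_pos (Metric.measure_ball_pos volume (0 : Rd d) one_pos).ne'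
    measure_ball_lt_top.ne
  unfold minorConst
  positivity

/-- Only the coupled part is kept. In the variable `σ⁻¹ • stepX`, the overlap is that of Gaussian
densities centred at the two rescaled means; both are bounded below on the unit ball when these
means have norm at most `ρ`. -/
theorem minorConst_smul_diagBall_le (hΔt : 0 < Δt) (hβ : 0 < β) (hb : Continuous b)
    (hF : Continuous F) (z : Rd d × Rd d) {ρ : ℝ}
    (hx : ‖z.1 + Δt • (b z.1 + η • F z.1)‖ ≤ √(2 * Δt / β) * ρ)
    (hy : ‖z.2 + Δt • b z.2‖ ≤ √(2 * Δt / β) * ρ) :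
    ENNReal.ofReal (minorConst d ρ) • diagBall d √(2 * Δt / β) ≤ stickyKernel b F η Δt β z := by
  set σ := √(2 * Δt / β) with hσ
  have hσ0 : 0 < σ := Real.sqrt_pos.2 (by positivity)
  have hσi : √(β / (2 * Δt)) = σ⁻¹ := by
    rw [hσ, ← Real.sqrt_inv, inv_div]
  set u := z.1 + Δt • (b z.1 + η • F z.1) with hu
  set v := z.2 + Δt • b z.2 with hv
  have huv : u + diffVec b F η Δt z.1 z.2 = v := by
    rw [hu, hv, diffVec]
    module
  have hψ : Measurable fun g : Rd d => (σ • g, σ • g) := Continuous.measurable (by fun_prop)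
  refine Measure.le_iff.2 fun A hA => ?_
  have hm0 := (Metric.measure_ball_pos volume (0 : Rd d) one_pos).ne'
  have hmt := (measure_ball_lt_top (μ := volume) (x := (0 : Rd d)) (r := 1)).ne
  have hA1 : Measurable (A.indicator (1 : Rd d × Rd d → ℝ≥0∞)) := measurable_one.indicator hA
  set ε := (2 * Real.pi) ^ (-(d : ℝ) / 2) * Real.exp (-(1 + ρ) ^ 2 / 2) with hε
  have hlow : ∀ (g w : Rd d), ‖g‖ < 1 → ‖w‖ ≤ σ * ρ → ε ≤ gaussDensity (g - σ⁻¹ • w) := by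
    intro g w hg hw
    have h1 : ‖g - σ⁻¹ • w‖ ≤ 1 + ρ := by
      refine (norm_sub_le _ _).trans (add_le_add hg.le ?_)
      rw [norm_smul, Real.norm_eq_abs, abs_of_pos (inv_pos.2 hσ0), inv_mul_le_iff₀ hσ0]
      exact hw
    rw [hε, gaussDensity]
    gcongr
  calc (ENNReal.ofReal (minorConst d ρ) • diagBall d σ) A
      = ∫⁻ g, (Metric.ball (0 : Rd d) 1).indicator
          (fun g => ENNReal.ofReal ε * A.indicator 1 (σ • g, σ • g)) g := by
        rw [Measure.smul_apply, smul_eq_mul, diagBall, Measure.map_apply hψ hA, cond_apply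
          measurableSet_ball, minorConst, ENNReal.ofReal_mul (by positivity),
          ENNReal.ofReal_toReal hmt, mul_assoc, ← mul_assoc (volume _),
          ENNReal.mul_inv_cancel hm0 hmt, one_mul, lintegral_indicator measurableSet_ball,
          lintegral_const_mul (f := fun g : Rd d => A.indicator 1 (σ • g, σ • g)) _
            (hA1.comp hψ)]
        have h2 : (fun g : Rd d => A.indicator (1 : Rd d × Rd d → ℝ≥0∞) (σ • g, σ • g)) =
            ((fun g : Rd d => (σ • g, σ • g)) ⁻¹' A).indicator 1 := rfl
        rw [h2, lintegral_indicator_one (hψ hA), Measure.restrict_apply (hψ hA), Set.inter_comm]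
    _ ≤ ∫⁻ g, ENNReal.ofReal (min (gaussDensity (g - σ⁻¹ • u))
          (gaussDensity (g - σ⁻¹ • u - σ⁻¹ • diffVec b F η Δt z.1 z.2))) *
            A.indicator 1 (stepX b F η Δt β z.1 (g - σ⁻¹ • u),
              stepX b F η Δt β z.1 (g - σ⁻¹ • u)) := by
        refine lintegral_mono fun g => ?_
        by_cases hg : g ∈ Metric.ball (0 : Rd d) 1
        · have hX : stepX b F η Δt β z.1 (g - σ⁻¹ • u) = σ • g := by
            rw [stepX, ← hσ, ← hu, smul_sub, smul_inv_smul₀ hσ0.ne']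
            abel
          rw [Set.indicator_of_mem hg, hX, sub_sub, ← smul_add, huv]
          have hg1 : ‖g‖ < 1 := by simpa using hg
          gcongr
          exact le_min (hlow g u hg1 hx) (hlow g v hg1 hy)
        · rw [Set.indicator_of_notMem hg]
          exact zero_le
    _ = ∫⁻ g, ENNReal.ofReal (min (gaussDensity g)
          (gaussDensity (g - √(β / (2 * Δt)) • diffVec b F η Δt z.1 z.2))) *
            A.indicator 1 (stepX b F η Δt β z.1 g, stepX b F η Δt β z.1 g) := by
        rw [hσi]
        exact lintegral_sub_right_eq_self (fun g => ENNReal.ofReal (min (gaussDensity g)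
          (gaussDensity (g - σ⁻¹ • diffVec b F η Δt z.1 z.2))) *
            A.indicator 1 (stepX b F η Δt β z.1 g, stepX b F η Δt β z.1 g)) (σ⁻¹ • u)
    _ ≤ stickyKernel b F η Δt β z A := by
        rw [← lintegral_indicator_one hA, lintegral_stickyKernel hb hF z hA1]
        exact lintegral_mono fun g => le_self_add

end Minorization

/-! ### Lyapunov drift of the Euler-Maruyama step. -/

section Drift

variable {d : ℕ} {b F : Rd d → Rd d} {Lb LF : ℝ≥0} {m M ηstar : ℝ}

/-- Compare with the point `0`: contractivity applies for `‖x‖ ≥ M`, and inside that ball the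
Lipschitz bound costs at most `(m + Lb) * M ^ 2`. The bounded `η • F` enters only the linear term.
-/
theorem DriftAssumption.exists_inner_le (h : DriftAssumption b F Lb LF m M) (hη : 0 ≤ ηstar) :
    ∃ A A' : ℝ, 0 ≤ A ∧ 0 ≤ A' ∧ ∀ η : ℝ, |η| ≤ ηstar → ∀ x,
      inner ℝ x (b x + η • F x) ≤ -m * ‖x‖ ^ 2 + A * ‖x‖ + A' ∧
      ‖b x + η • F x‖ ≤ A + Lb * ‖x‖ := by
  obtain ⟨B, hB⟩ := h.bounded_F
  have hB0 : 0 ≤ B := (norm_nonneg _).trans (hB 0)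
  have hm := h.m_pos
  have hM := h.M_nonneg
  refine ⟨‖b 0‖ + ηstar * B, (m + Lb) * M ^ 2, by positivity, by positivity, fun η hη' x => ?_⟩
  have h1 : ‖η • F x‖ ≤ ηstar * B := by
    rw [norm_smul, Real.norm_eq_abs]
    exact mul_le_mul hη' (hB x) (norm_nonneg _) hη
  have h2 : ‖b x - b 0‖ ≤ Lb * ‖x‖ := by
    simpa [dist_eq_norm] using h.lipschitz_b.dist_le_mul x 0
  have h3 : b x + η • F x = (b x - b 0) + (b 0 + η • F x) := by abel
  have h4 : ‖b 0 + η • F x‖ ≤ ‖b 0‖ + ηstar * B := (norm_add_le _ _).trans (by gcongr)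
  constructor
  · have h5 : inner ℝ x (b 0 + η • F x) ≤ (‖b 0‖ + ηstar * B) * ‖x‖ := by
      refine (real_inner_le_norm _ _).trans ?_
      rw [mul_comm]
      gcongr
    have h6 : inner ℝ x (b x - b 0) ≤ -m * ‖x‖ ^ 2 + (m + Lb) * M ^ 2 := by
      rcases le_total M ‖x‖ with hx | hx
      · have h7 := h.contractive x 0 (by simpa using hx)
        simp only [sub_zero] at h7
        have : 0 ≤ (m + Lb) * M ^ 2 := by positivity
        linarith
      · have h7 : inner ℝ x (b x - b 0) ≤ ‖x‖ * (Lb * ‖x‖) :=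
          (real_inner_le_norm _ _).trans (by gcongr)
        have h8 : (m + Lb) * ‖x‖ ^ 2 ≤ (m + Lb) * M ^ 2 := by gcongr
        linarith
    rw [h3, inner_add_right]
    linarith
  · rw [h3]
    refine (norm_add_le _ _).trans ?_
    linarith

/-- Expand the square. Of the decay `-2 m Δt ‖x‖ ^ 2`, a quarter pays for the quadratic growth of
the drift, by the step-size condition, and a quarter absorbs the linear terms through Young's
inequality. -/
theorem DriftAssumption.exists_sq_norm_le (h : DriftAssumption b F Lb LF m M) (hη : 0 ≤ ηstar) :
    ∃ K : ℝ, 0 ≤ K ∧ ∀ Δt : ℝ, 0 < Δt → Δt * m ≤ 1 → Δt * (2 * (Lb : ℝ) ^ 2) ≤ m →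
      ∀ η : ℝ, |η| ≤ ηstar → ∀ x,
        ‖x + Δt • (b x + η • F x)‖ ^ 2 ≤ (1 - m * Δt) * ‖x‖ ^ 2 + K * Δt := by
  obtain ⟨A, A', hA, hA', hdrift⟩ := h.exists_inner_le hη
  have hm := h.m_pos
  set H := 2 * A + 2 * A * Lb / m with hH
  refine ⟨H ^ 2 / (2 * m) + 2 * A' + A ^ 2 / m, by positivity, fun Δt hΔt hΔtm hΔtL η hη' x => ?_⟩
  obtain ⟨h1, h2⟩ := hdrift η hη' x
  set r := ‖x‖ with hr
  have hr0 : 0 ≤ r := norm_nonneg x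
  have hΔtm' : Δt ≤ 1 / m := (le_div_iff₀ hm).2 hΔtm
  have h3 : ‖b x + η • F x‖ ^ 2 ≤ (A + Lb * r) ^ 2 := by gcongr
  have h4 : Δt * (A + Lb * r) ^ 2 ≤ A ^ 2 / m + 2 * A * Lb / m * r + m / 2 * r ^ 2 := by
    have e1 : Δt * A ^ 2 ≤ 1 / m * A ^ 2 := by gcongr
    have e2 : Δt * (2 * A * Lb * r) ≤ 1 / m * (2 * A * Lb * r) := by gcongr
    have e3 : Δt * (2 * (Lb : ℝ) ^ 2) * r ^ 2 ≤ m * r ^ 2 := by gcongr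
    have e4 : A ^ 2 / m + 2 * A * Lb / m * r = 1 / m * A ^ 2 + 1 / m * (2 * A * Lb * r) := by
      ring
    rw [e4]
    linarith
  have h5 : H * r ≤ m / 2 * r ^ 2 + H ^ 2 / (2 * m) := by
    have e : m / 2 * r ^ 2 + H ^ 2 / (2 * m) - H * r = (m * r - H) ^ 2 / (2 * m) := by
      field_simp
      ring
    have : 0 ≤ (m * r - H) ^ 2 / (2 * m) := by positivity
    linarith
  rw [norm_add_sq_real, real_inner_smul_right, norm_smul, mul_pow, Real.norm_eq_abs, sq_abs]
  have h6 : Δt ^ 2 * ‖b x + η • F x‖ ^ 2 ≤ Δt * (Δt * (A + Lb * r) ^ 2) := by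
    rw [sq, mul_assoc]
    gcongr
  have h7 : 2 * inner ℝ x (b x + η • F x) + Δt * (A + Lb * r) ^ 2 ≤
      -m * r ^ 2 + (H ^ 2 / (2 * m) + 2 * A' + A ^ 2 / m) := by
    have : H * r = 2 * A * r + 2 * A * Lb / m * r := by rw [hH]; ring
    linarith
  have h8 := mul_le_mul_of_nonneg_left h7 hΔt.le
  linarith

/-- Exponential drift from a decay of the exponent at infinity. -/
theorem exists_exp_drift {m k K c : ℝ} (hm : 0 < m) (hk : 0 < k) (hK : 0 ≤ K) (hc : 0 < c) :
    ∃ K' : ℝ, 0 ≤ K' ∧ ∀ Δt : ℝ, 0 < Δt → m * Δt ≤ 1 → ∀ s : ℝ, 0 ≤ s →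
      Real.exp (Δt * (K - k * s)) * Real.exp (c * s) ≤
        (1 - m / 2 * Δt) * Real.exp (c * s) + K' * Δt := by
  set W := Real.exp (c * ((K + m) / k)) with hW
  have hW0 : 0 < W := Real.exp_pos _
  refine ⟨(K * Real.exp (K / m) + m / 2) * W, by positivity, fun Δt hΔt hΔtm s hs => ?_⟩
  have hE := Real.exp_pos (c * s)
  -- Far out the exponent is at most `-m Δt`, and `m Δt ≤ 1` makes its exponential at most `1 - m Δt
  -- / 2`. Elsewhere `exp (c s)` is bounded and the growth factor is `1 + O(Δt)`.
  rcases le_total (K + m) (k * s) with h | h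
  · have h1 : Real.exp (Δt * (K - k * s)) ≤ 1 - m / 2 * Δt := by
      have h2 : Δt * (K - k * s) ≤ -(m * Δt) := by nlinarith
      have h3 : 1 + m * Δt ≤ Real.exp (m * Δt) := by linarith [Real.add_one_le_exp (m * Δt)]
      have h4 : 0 < m * Δt := by positivity
      calc Real.exp (Δt * (K - k * s)) ≤ Real.exp (-(m * Δt)) := Real.exp_le_exp.2 h2
        _ = (Real.exp (m * Δt))⁻¹ := Real.exp_neg _
        _ ≤ (1 + m * Δt)⁻¹ := by gcongr
        _ ≤ 1 - m / 2 * Δt := by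
          rw [inv_le_iff_one_le_mul₀ (by positivity)]
          nlinarith
    have h5 := mul_le_mul_of_nonneg_right h1 hE.le
    have h6 : 0 ≤ (K * Real.exp (K / m) + m / 2) * W * Δt := by positivity
    linarith
  · have h1 : Real.exp (c * s) ≤ W := by
      rw [hW, Real.exp_le_exp]
      gcongr
      rw [le_div_iff₀ hk, mul_comm]
      exact h
    have h2 : Real.exp (Δt * (K - k * s)) ≤ 1 + K * Real.exp (K / m) * Δt := by
      have h3 : Δt * (K - k * s) ≤ Δt * K := by
        gcongr
        linarith [mul_nonneg hk.le hs]
      have h4 : Δt * K ≤ K / m := by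
        rw [le_div_iff₀ hm]
        nlinarith
      have h5 : Real.exp (Δt * K) ≤ 1 + Δt * K * Real.exp (Δt * K) := by
        have h6 := Real.add_one_le_exp (-(Δt * K))
        have h7 := mul_le_mul_of_nonneg_right h6 (Real.exp_pos (Δt * K)).le
        rw [← Real.exp_add, neg_add_cancel, Real.exp_zero] at h7
        linarith
      calc Real.exp (Δt * (K - k * s)) ≤ Real.exp (Δt * K) := Real.exp_le_exp.2 h3
        _ ≤ 1 + Δt * K * Real.exp (Δt * K) := h5
        _ ≤ 1 + Δt * K * Real.exp (K / m) := by gcongr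
        _ = 1 + K * Real.exp (K / m) * Δt := by ring
    have h3 := mul_le_mul_of_nonneg_right h2 hE.le
    have h4 : (K * Real.exp (K / m) + m / 2) * Δt * Real.exp (c * s) ≤
        (K * Real.exp (K / m) + m / 2) * Δt * W := by gcongr
    linarith

/-- From `log (1 - s) ≥ 1 - (1 - s)⁻¹ ≥ -2 s` for `s ≤ 1 / 2`. -/
theorem rpow_neg_half_le_exp (d : ℕ) {s : ℝ} (hs0 : 0 ≤ s) (hs : s ≤ 1 / 2) :
    (1 - s) ^ (-(d : ℝ) / 2) ≤ Real.exp (d * s) := by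
  have h0 : 0 < 1 - s := by linarith
  rw [Real.rpow_def_of_pos h0, Real.exp_le_exp]
  have h1 := Real.one_sub_inv_le_log_of_pos h0
  have h2 : -(2 * s) ≤ 1 - (1 - s)⁻¹ := by
    have : (1 - s)⁻¹ ≤ 1 + 2 * s := by
      rw [inv_le_iff_one_le_mul₀ h0]
      nlinarith
    linarith
  have h3 : (0 : ℝ) ≤ d := Nat.cast_nonneg d
  nlinarith

/-- One-step drift of `exp (c |x|²)` for the Euler-Maruyama scheme, with an increment of order
`Δt` and constants uniform in the step size. -/
theorem DriftAssumption.exists_lintegral_exp_le (h : DriftAssumption b F Lb LF m M)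
    (hη : 0 ≤ ηstar) {β : ℝ} (hβ : 0 < β) :
    ∃ c K : ℝ, 0 < c ∧ 0 ≤ K ∧
      ∀ Δt : ℝ, 0 < Δt → Δt * m ≤ 1 → Δt * (2 * (Lb : ℝ) ^ 2) ≤ m →
      ∀ η : ℝ, |η| ≤ ηstar → ∀ x,
        ∫⁻ g, ENNReal.ofReal (Real.exp (c *
          ‖x + Δt • (b x + η • F x) + √(2 * Δt / β) • g‖ ^ 2)) ∂(stdGaussian (Rd d)) ≤
        ENNReal.ofReal ((1 - m / 2 * Δt) * Real.exp (c * ‖x‖ ^ 2) + K * Δt) := by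
  obtain ⟨K₁, hK₁, hstep⟩ := h.exists_sq_norm_le hη
  have hm := h.m_pos
  -- With variance `2 Δt / β` this gives `q = 1 - m Δt / 2`. Since `1 - m Δt ≤ q ^ 2`, dividing by
  -- `q` still leaves a factor `q` in front of `c ‖x‖ ^ 2`.
  set c := m * β / 8 with hc
  have hc0 : 0 < c := by positivity
  -- The term `d * m / 2` comes from the normalization `q ^ (-d / 2)`, and `2 * c * K₁` from
  -- dividing by `q ≥ 1 / 2`.
  obtain ⟨K, hK, hexp⟩ := exists_exp_drift (m := m) (k := c * m / 2)
    (K := d * m / 2 + 2 * c * K₁) (c := c) hm (by positivity) (by positivity) hc0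
  refine ⟨c, K, hc0, hK, fun Δt hΔt hΔtm hΔtL η hη' x => ?_⟩
  set q := 1 - m * Δt / 2 with hq
  have hq2 : 1 / 2 ≤ q := by rw [hq]; linarith
  have hq0 : 0 < q := by linarith
  rw [lintegral_exp_sq_norm_stdGaussian hq0 (by
    rw [Real.sq_sqrt (by positivity), hc, hq]
    field_simp
    ring)]
  refine ENNReal.ofReal_le_ofReal ?_
  refine le_trans ?_ (hexp Δt hΔt (by linarith) (‖x‖ ^ 2) (by positivity))
  have h1 : q ^ (-(d : ℝ) / 2) ≤ Real.exp (d * (m * Δt / 2)) :=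
    rpow_neg_half_le_exp d (by positivity) (by linarith)
  have h2 : c * ‖x + Δt • (b x + η • F x)‖ ^ 2 / q ≤ c * q * ‖x‖ ^ 2 + 2 * c * K₁ * Δt := by
    rw [div_le_iff₀ hq0]
    have e1 := mul_le_mul_of_nonneg_left (hstep Δt hΔt hΔtm hΔtL η hη' x) hc0.le
    have e2 : (1 - m * Δt) * (c * ‖x‖ ^ 2) ≤ q * q * (c * ‖x‖ ^ 2) := by
      gcongr
      rw [hq]
      nlinarith [sq_nonneg (m * Δt)]
    have e3 : 1 / 2 * (2 * c * K₁ * Δt) ≤ q * (2 * c * K₁ * Δt) := by gcongr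
    linarith
  calc q ^ (-(d : ℝ) / 2) * Real.exp (c * ‖x + Δt • (b x + η • F x)‖ ^ 2 / q)
      ≤ Real.exp (d * (m * Δt / 2)) * Real.exp (c * q * ‖x‖ ^ 2 + 2 * c * K₁ * Δt) := by gcongr
    _ = _ := by
      rw [← Real.exp_add, ← Real.exp_add, hq]
      congr 1
      ring

end Drift

/-! ### Uniform constants and assembly. -/

section Main

/-- The prefactor of a geometric bound can be traded against its rate in the presence of a uniform
bound. -/
theorem exists_rate_min_le {A γ C : ℝ} (hA : 0 < A) (hγ0 : 0 < γ) (hγ1 : γ < 1) (hC : 1 ≤ C) :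
    ∃ γ' : ℝ, 0 < γ' ∧ γ' < 1 ∧ ∀ n : ℕ, min (A * γ ^ n) C ≤ 2 * C * γ' ^ n := by
  -- Choose `N` with `A < 2 ^ N` and let `γ'` be the `(N + 1)`-th root of `γ`. In the `(N + 1)`-th
  -- power of the minimum, one factor uses the geometric bound and `N` factors use `C`; the `2` in
  -- `2 * C` absorbs `A`.
  obtain ⟨N, hN⟩ := pow_unbounded_of_one_lt A one_lt_two
  have hN' : (0 : ℝ) < ((N + 1 : ℕ) : ℝ) := by positivity
  refine ⟨γ ^ ((N + 1 : ℕ) : ℝ)⁻¹, Real.rpow_pos_of_pos hγ0 _,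
    Real.rpow_lt_one hγ0.le hγ1 (inv_pos.2 hN'), fun n => ?_⟩
  set γ' := γ ^ ((N + 1 : ℕ) : ℝ)⁻¹ with hγ'
  have hγ'0 : 0 < γ' := Real.rpow_pos_of_pos hγ0 _
  have hγ'N : γ' ^ (N + 1) = γ := Real.rpow_inv_natCast_pow hγ0.le (Nat.succ_ne_zero N)
  have hmin0 : 0 ≤ min (A * γ ^ n) C := le_min (by positivity) (by linarith)
  refine le_of_pow_le_pow_left₀ (Nat.succ_ne_zero N) (by positivity) ?_
  calc min (A * γ ^ n) C ^ (N + 1) = min (A * γ ^ n) C ^ N * min (A * γ ^ n) C := pow_succ _ _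
    _ ≤ C ^ N * (A * γ ^ n) := by
        gcongr
        · exact min_le_right _ _
        · exact min_le_left _ _
    _ ≤ C ^ (N + 1) * (2 ^ (N + 1) * γ ^ n) := by
        gcongr
        · exact Nat.le_succ N
        · exact hN.le.trans (pow_le_pow_right₀ one_le_two (Nat.le_succ N))
    _ = (2 * C * γ' ^ n) ^ (N + 1) := by
        rw [mul_pow, mul_pow, ← pow_mul, mul_comm n, pow_mul, hγ'N]
        ring

variable {α : Type*} {V f : α → ℝ}

theorem weightedNorm_le_ofReal (hV : ∀ z, 0 < V z) {B : ℝ} (h : ∀ z, |f z| ≤ B * V z) :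
    weightedNorm V f ≤ ENNReal.ofReal B :=
  iSup_le fun z => ENNReal.ofReal_le_ofReal ((div_le_iff₀ (hV z)).2 (h z))

theorem abs_le_of_weightedNorm_lt_top (hV : ∀ z, 0 < V z) (h : weightedNorm V f < ⊤) (z : α) :
    |f z| ≤ (weightedNorm V f).toReal * V z := by
  rw [← div_le_iff₀ (hV z)]
  exact (ENNReal.ofReal_le_iff_le_toReal h.ne).1
    (le_iSup (fun z => ENNReal.ofReal (|f z| / V z)) z)

variable {d : ℕ} {b F : Rd d → Rd d} {Lb LF : ℝ≥0} {m M ηstar : ℝ}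

theorem measurable_lyapunov (c : ℝ) : Measurable (lyapunov c : Rd d × Rd d → ℝ) :=
  Continuous.measurable (by unfold lyapunov; fun_prop)

theorem one_le_lyapunov {c : ℝ} (hc : 0 ≤ c) (z : Rd d × Rd d) : 1 ≤ lyapunov c z := by
  have h1 : 1 ≤ Real.exp (c * ‖z.1‖ ^ 2) := Real.one_le_exp (by positivity)
  have h2 := Real.exp_pos (c * ‖z.2‖ ^ 2)
  unfold lyapunov
  linarith

/-- The drift condition for the sticky-coupled chain, with constants uniform in the step size and
in the strength of the perturbation. -/
theorem DriftAssumption.exists_lintegral_lyapunov_le (h : DriftAssumption b F Lb LF m M)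
    (hη : 0 ≤ ηstar) {β : ℝ} (hβ : 0 < β) :
    ∃ c K : ℝ, 0 < c ∧ 0 ≤ K ∧
      ∀ Δt : ℝ, 0 < Δt → Δt * m ≤ 1 → Δt * (2 * (Lb : ℝ) ^ 2) ≤ m →
      ∀ η : ℝ, |η| ≤ ηstar → ∀ z,
        ∫⁻ w, ENNReal.ofReal (lyapunov c w) ∂(stickyKernel b F η Δt β z) ≤
          ENNReal.ofReal ((1 - m / 2 * Δt) * lyapunov c z + K * Δt) := by
  obtain ⟨c, K, hc, hK, hexp⟩ := h.exists_lintegral_exp_le hη hβ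
  have hb := h.lipschitz_b.continuous
  have hF := h.lipschitz_F.continuous
  have hm := h.m_pos
  refine ⟨c, 2 * K, hc, by positivity, fun Δt hΔt hΔtm hΔtL η hη' z => ?_⟩
  have hcoef : 0 ≤ 1 - m / 2 * Δt := by linarith
  have hmeas : Measurable fun x : Rd d => ENNReal.ofReal (Real.exp (c * ‖x‖ ^ 2)) :=
    (Continuous.measurable (by fun_prop)).ennreal_ofReal
  have h1 := hexp Δt hΔt hΔtm hΔtL η hη' z.1
  -- The second component moves with the unperturbed drift, hence `η = 0`.
  have h2 := hexp Δt hΔt hΔtm hΔtL 0 (by simpa using hη) z.2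
  simp only [zero_smul, add_zero] at h2
  have h3 : ∀ w : Rd d × Rd d, ENNReal.ofReal (lyapunov c w) =
      ENNReal.ofReal (Real.exp (c * ‖w.1‖ ^ 2)) + ENNReal.ofReal (Real.exp (c * ‖w.2‖ ^ 2)) :=
    fun w => ENNReal.ofReal_add (Real.exp_pos _).le (Real.exp_pos _).le
  simp_rw [h3]
  rw [lintegral_add_left
      (f := fun w : Rd d × Rd d => ENNReal.ofReal (Real.exp (c * ‖w.1‖ ^ 2)))
      (hmeas.comp measurable_fst),
    lintegral_stickyKernel_fst hb hF z hmeas, lintegral_stickyKernel_snd hΔt hβ hb hF z hmeas]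
  refine (add_le_add h1 h2).trans ?_
  rw [← ENNReal.ofReal_add (by positivity) (by positivity)]
  refine ENNReal.ofReal_le_ofReal ?_
  unfold lyapunov
  linarith

/-- The minorization condition for the sticky-coupled chain on sublevel sets of the Lyapunov
function, uniformly in the strength of the perturbation. -/
theorem DriftAssumption.exists_minorization (h : DriftAssumption b F Lb LF m M)
    (hη : 0 ≤ ηstar) {β : ℝ} (hβ : 0 < β) {c : ℝ} (hc : 0 < c) (R : ℝ) {Δt : ℝ} (hΔt : 0 < Δt)
    (hΔtm : Δt * m ≤ 1) (hΔtL : Δt * (2 * (Lb : ℝ) ^ 2) ≤ m) :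
    ∃ a : ℝ, 0 < a ∧ ∀ η : ℝ, |η| ≤ ηstar → ∀ z : Rd d × Rd d, lyapunov c z ≤ R →
      ENNReal.ofReal a • diagBall d √(2 * Δt / β) ≤ stickyKernel b F η Δt β z := by
  obtain ⟨K, hK, hstep⟩ := h.exists_sq_norm_le hη
  have hm := h.m_pos
  set σ := √(2 * Δt / β) with hσ
  have hσ0 : 0 < σ := Real.sqrt_pos.2 (by positivity)
  refine ⟨minorConst d (√(R / c + K * Δt) / σ), minorConst_pos _ _, fun η hη' z hz => ?_⟩
  have hbound : ∀ (η : ℝ) (x : Rd d), |η| ≤ ηstar → Real.exp (c * ‖x‖ ^ 2) ≤ R →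
      ‖x + Δt • (b x + η • F x)‖ ≤ √(R / c + K * Δt) := by
    intro η x hη' hx
    refine Real.le_sqrt_of_sq_le ((hstep Δt hΔt hΔtm hΔtL η hη' x).trans ?_)
    -- The crude inequality `1 + s ≤ exp s` suffices to bound the sublevel set.
    have h1 : ‖x‖ ^ 2 ≤ R / c := by
      rw [le_div_iff₀ hc]
      linarith [Real.add_one_le_exp (c * ‖x‖ ^ 2)]
    have h2 : 0 ≤ m * Δt * ‖x‖ ^ 2 := by positivity
    linarith
  have h1 := Real.exp_pos (c * ‖z.1‖ ^ 2)
  have h2 := Real.exp_pos (c * ‖z.2‖ ^ 2)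
  unfold lyapunov at hz
  refine minorConst_smul_diagBall_le hΔt hβ h.lipschitz_b.continuous h.lipschitz_F.continuous z
    ?_ ?_
  · rw [← hσ, mul_div_cancel₀ _ hσ0.ne']
    exact hbound η z.1 hη' (by linarith)
  · rw [← hσ, mul_div_cancel₀ _ hσ0.ne']
    simpa using hbound 0 z.2 (by simpa using hη) (by linarith)

theorem mul_two_mul_sq_le_of_lt_div {Δt L L' m : ℝ} (hΔt : 0 < Δt) (hL : 0 ≤ L) (hLL' : L ≤ L')
    (h : Δt < m / (2 * L' ^ 2)) : Δt * (2 * L ^ 2) ≤ m := by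
  have hL' : 0 < 2 * L' ^ 2 := by
    -- If `L' = 0`, then `m / 0 = 0` and no positive step satisfies `h`.
    rcases (hL.trans hLL').eq_or_lt with h0 | h0
    · rw [← h0] at h
      norm_num at h
      linarith
    · positivity
  have h1 := (lt_div_iff₀ hL').1 h
  refine le_trans ?_ h1.le
  gcongr

end Main

end StickyCoupling

end

theorem mainTheorem6 {d : ℕ} (b F : StickyCoupling.Rd d → StickyCoupling.Rd d)
    (Lb LF : ℝ≥0) (m M : ℝ) (hbF : StickyCoupling.DriftAssumption b F Lb LF m M)
    (β : ℝ) (hβ : 0 < β) (ηstar : ℝ) (hηstar : 0 < ηstar) :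
    ∃ C : ℝ, 0 < C ∧ ∃ c : ℝ, 0 < c ∧
      ∀ Δt : ℝ, 0 < Δt → Δt < min (1 / m) (m / (2 * ((Lb : ℝ) + ηstar * (LF : ℝ)) ^ 2)) →
        ∃ γ : ℝ, 0 < γ ∧ γ < 1 ∧
          ∀ η : ℝ, |η| ≤ ηstar →
            ∃ μ : Measure (StickyCoupling.Rd d × StickyCoupling.Rd d),
              (IsProbabilityMeasure μ ∧
                Kernel.Invariant (StickyCoupling.stickyKernel b F η Δt β) μ) ∧
              (∀ μ' : Measure (StickyCoupling.Rd d × StickyCoupling.Rd d),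
                IsProbabilityMeasure μ' →
                Kernel.Invariant (StickyCoupling.stickyKernel b F η Δt β) μ' → μ' = μ) ∧
              ∀ φ : StickyCoupling.Rd d × StickyCoupling.Rd d → ℝ, Measurable φ →
                StickyCoupling.weightedNorm (StickyCoupling.lyapunov c) φ < ⊤ →
                Integrable φ μ ∧
                ∀ n : ℕ,
                  (∀ z, Integrable φ ((StickyCoupling.stickyKernel b F η Δt β ^ n) z)) ∧
                  StickyCoupling.weightedNorm (StickyCoupling.lyapunov c)
                      (fun z => (∫ w, φ w ∂((StickyCoupling.stickyKernel b F η Δt β ^ n) z))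
                        - ∫ w, φ w ∂μ) ≤
                    ENNReal.ofReal (C * γ ^ n) *
                      StickyCoupling.weightedNorm (StickyCoupling.lyapunov c)
                        (fun z => φ z - ∫ w, φ w ∂μ) := by
  open StickyCoupling in
  obtain ⟨c, K, hc, hK, hdrift⟩ := hbF.exists_lintegral_lyapunov_le hηstar.le hβ
  have hm := hbF.m_pos
  have hC1 : 1 ≤ 1 + 2 * K / m := by
    have : 0 ≤ 2 * K / m := by positivity
    linarith
  refine ⟨2 * (1 + 2 * K / m), by linarith, c, hc, fun Δt hΔt hΔt' => ?_⟩
  have hΔt1 : Δt * m < 1 := (lt_div_iff₀ hm).1 (hΔt'.trans_le (min_le_left _ _))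
  have hΔtL : Δt * (2 * (Lb : ℝ) ^ 2) ≤ m :=
    mul_two_mul_sq_le_of_lt_div hΔt Lb.2 (le_add_of_nonneg_right (by positivity))
      (hΔt'.trans_le (min_le_right _ _))
  have hV1 := one_le_lyapunov (d := d) hc.le
  have hV0 : ∀ z : Rd d × Rd d, 0 < lyapunov c z := fun z => zero_lt_one.trans_le (hV1 z)
  set r := 1 - m / 2 * Δt with hr
  have hr0 : 0 < r := by rw [hr]; linarith
  have hr1 : r < 1 := by rw [hr]; linarith [mul_pos hm hΔt]
  -- The additive drift term and `1 - r` are both proportional to `Δt`; their ratio is not affected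
  -- by the step, so `C` can be fixed before `Δt`.
  have hKr : K * Δt / (1 - r) = 2 * K / m := by
    rw [hr]
    field_simp
    ring
  obtain ⟨a, ha, hminor⟩ := hbF.exists_minorization hηstar.le hβ hc
    (2 * (K * Δt) / (1 - r) + 1) hΔt hΔt1.le hΔtL
  -- The constants are produced before the kernel is chosen, so `γ` and `A` serve all `η` at once.
  obtain ⟨γ, A, hγ0, hγ1, hA, hharris⟩ := exists_harris (lyapunov c) (measurable_lyapunov c) hV1
    ((0 : Rd d), (0 : Rd d)) hr0 hr1 (by positivity) ha (lt_add_one (2 * (K * Δt) / (1 - r)))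
  obtain ⟨γ', hγ'0, hγ'1, hmin⟩ := exists_rate_min_le hA hγ0 hγ1 hC1
  refine ⟨γ', hγ'0, hγ'1, fun η hη => ?_⟩
  obtain ⟨μ, hμ, huniq, hconv⟩ := hharris (stickyKernel b F η Δt β) (diagBall d √(2 * Δt / β))
    (isMarkovKernel_stickyKernel η Δt β hbF.lipschitz_b.continuous hbF.lipschitz_F.continuous)
    (isProbabilityMeasure_diagBall d _) (hdrift Δt hΔt hΔt1.le hΔtL η hη) (hminor η hη)
  refine ⟨μ, hμ, huniq, fun φ hφ hφV => ?_⟩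
  obtain ⟨hint, hn⟩ := hconv φ hφ _ (abs_le_of_weightedNorm_lt_top hV0 hφV)
  refine ⟨hint, fun n => ⟨(hn n).1, ?_⟩⟩
  have hCγ : 0 < 2 * (1 + 2 * K / m) * γ' ^ n := by positivity
  -- An infinite norm on the right makes the bound trivial, because its prefactor is positive.
  rcases eq_or_ne (weightedNorm (lyapunov c) fun z => φ z - ∫ w, φ w ∂μ) ⊤ with htop | htop
  · rw [htop, ENNReal.mul_top (ENNReal.ofReal_pos.2 hCγ).ne']
    exact le_top
  · rw [← ENNReal.ofReal_toReal htop, ← ENNReal.ofReal_mul hCγ.le]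
    refine weightedNorm_le_ofReal hV0 fun z => ?_
    refine ((hn n).2 _ (abs_le_of_weightedNorm_lt_top hV0 htop.lt_top) z).trans ?_
    rw [hKr, mul_comm (2 * (1 + 2 * K / m) * γ' ^ n)]
    have := hV0 z
    gcongr
    exact hmin n
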